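/- Let $\gamma>0$, $m\in\mathbb R$. For $u\in BV(\mathbb S^2;\{\pm1\})$ with mean $\frac1{4\pi}\int_{\mathbb S^2}u\,d\mathcal H^2=m$ put $$E_\gamma(u)=\frac12\int_{\mathbb S^2}|\nabla u|+\gamma\int_{\mathbb S^2}|\nabla v|^2\,d\mathcal H^2,\qquad -\Delta v=u-m\ \text{ on }\mathbb S^2 .$$ For $-1=z_0<z_1<\dots<z_n<z_{n+1}=1$ let $u_z$ be the axisymmetric pattern with interfaces $z=(z_1,\dots,z_n)$, that is, the function on $\mathbb S^2$ equal to $(-1)^{k+1}$ at the points whose height (third coordinate) lies in $[z_k,z_{k+1})$, $0\le k\le n$ (the last interval includes $1$). Suppose that $u=u_z$ has mean $m$ and is a critical point of $E_\gamma$ with respect to one-dimensional perturbations in the height variable, that is, $\frac{d}{dt}E_\gamma(u_{\zeta(t)})\big|_{t=0}=0$ for every smooth curve $\zeta:\mathbb R\to\mathbb R^n$ with $\zeta(0)=z$ and such that $u_{\zeta(t)}$ has mean $m$ for all $t$ near $0$. Let $A=\{x\in\mathbb S^2:u(x)=1\}$. Then $\partial A$ has a signed geodesic curvature $\kappa_g$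 with respect to the outer normal of $A$ (positive for caps smaller than a hemisphere), the Poisson problem $-\Delta v=u-m$ has a solution, and for every solution $v$ there is a single constant $\lambda$ such that $$\kappa_g(x)+4\gamma v(x)=\lambda\qquad\text{for all }x\in\partial A .$$ Thus $u$ is a critical point of $E_\gamma$ with respect to all perturbations, in the sense that it solves the full Euler–Lagrange equation; in particular the first variation vanishes in the weak form $\int_{\partial A}(\kappa_g+4\gamma v)f\,d\mathcal H^1=0$ for all smooth $f$ on $\partial A$ with $\int_{\partial A}f\,d\mathcal H^1=0$. -/

import Mathlib

open MeasureTheory Filter Topology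
open scoped ContDiff RealInnerProductSpace ENNReal

namespace SphereOK

noncomputable section

/-- Euclidean three-space. -/
abbrev E3 : Type := EuclideanSpace ℝ (Fin 3)

/-- The unit sphere `𝕊²`. -/
abbrev S2 : Type := Metric.sphere (0 : E3) 1

/-- The area measure of `𝕊²` (total mass `4π`). -/
def area : Measure S2 := (volume : Measure E3).toSphere

/-! ### First-order calculus on the sphere -/

/-- The extension of `f : 𝕊² → ℝ` to `ℝ³ ∖ {0}` that is constant along rays, `y ↦ f (y / |y|)`. -/
def radialExt (f : S2 → ℝ) (y : E3) : ℝ :=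
  Function.extend (Subtype.val : S2 → E3) f 0 (‖y‖⁻¹ • y)

/-- `f` is continuously differentiable on `𝕊²`. -/
def IsC1 (f : S2 → ℝ) : Prop := ContDiffOn ℝ 1 (radialExt f) {0}ᶜ

/-- The gradient of `f` relative to `𝕊²` at `x`, a vector of `ℝ³` tangent to `𝕊²` at `x`. It is
the Euclidean gradient at `x` of the extension of `f` that is constant along rays. -/
def sphereGrad (f : S2 → ℝ) (x : S2) : E3 := gradient (radialExt f) (x : E3)

/-- The divergence relative to `𝕊²` of (the restriction to `𝕊²` of) a vector field `X`, namely the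
trace of `DX(x)` over the tangent plane of `𝕊²` at `x`. -/
def sphereDiv (X : E3 → E3) (x : S2) : ℝ :=
  LinearMap.trace ℝ E3 (fderiv ℝ X (x : E3) : E3 →ₗ[ℝ] E3)
    - ⟪fderiv ℝ X (x : E3) (x : E3), (x : E3)⟫

/-- Smooth vector fields tangent to `𝕊²` with sup norm at most one on `𝕊²`. Every smooth tangent
field on `𝕊²` is the restriction of a smooth map `ℝ³ → ℝ³`. -/
structure IsUnitTangentField (X : E3 → E3) : Prop where
  smooth : ContDiff ℝ ∞ X
  tangent : ∀ x : S2, ⟪X x, (x : E3)⟫ = 0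
  norm_le_one : ∀ x : S2, ‖X x‖ ≤ 1

/-- The total variation `∫ |∇u|` of `u` on `𝕊²`. -/
def totalVariation (u : S2 → ℝ) : ℝ≥0∞ :=
  ⨆ (X : E3 → E3) (_ : IsUnitTangentField X),
    ENNReal.ofReal (∫ x, u x * sphereDiv X x ∂area)

/-! ### The energy -/

/-- The mean `(1 / 4π) ∫ u` of `u` over `𝕊²`. -/
def mass (u : S2 → ℝ) : ℝ := (1 / (4 * Real.pi)) * ∫ x, u x ∂area

/-- `v` is a solution of the Poisson problem `-Δ v = u - m` on `𝕊²`, in the weak sense. For bounded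
`u` all weak solutions are of class `C¹`, so that asking for this loses none of them, and the
equation may equivalently be tested with all test functions of class `C¹`. -/
structure IsPoissonSolution (u : S2 → ℝ) (m : ℝ) (v : S2 → ℝ) : Prop where
  isC1 : IsC1 v
  weak : ∀ φ : S2 → ℝ, IsC1 φ →
    ∫ x, ⟪sphereGrad v x, sphereGrad φ x⟫ ∂area = ∫ x, (u x - m) * φ x ∂area

open Classical in
/-- A solution `v` of `-Δ v = u - m`. It is unique up to an additive constant, so that its gradient
does not depend on the choice. (The value is `0` if there is no solution.) -/
def poissonSolution (u : S2 → ℝ) (m : ℝ) : S2 → ℝ :=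
  if h : ∃ v, IsPoissonSolution u m v then h.choose else 0

/-- The energy `E_γ(u) = ½ ∫ |∇u| + γ ∫ |∇v|²`, where `-Δ v = u - m`, for functions `u` of bounded
variation with mean `m`. -/
def energy (γ m : ℝ) (u : S2 → ℝ) : ℝ :=
  (1 / 2) * (totalVariation u).toReal
    + γ * ∫ x, ‖sphereGrad (poissonSolution u m) x‖ ^ 2 ∂area

/-! ### Axisymmetric patterns -/

/-- `z` lists the interfaces of an axisymmetric pattern: `-1 < z_1 < ⋯ < z_n < 1`. -/
structure IsInterfaces {n : ℕ} (z : Fin n → ℝ) : Prop where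
  strictMono : StrictMono z
  gt_neg_one : ∀ k, -1 < z k
  lt_one : ∀ k, z k < 1

/-- The axisymmetric pattern with interfaces `z_1 < ⋯ < z_n`, as a function on `𝕊²`: its value at
a point of height `h` is `(-1)^(k+1)` if exactly the `k` first interfaces are `≤ h`, that is, if
`z_k ≤ h < z_{k+1}` (where `z_0 = -1`, and where the last piece contains `h = 1`). -/
def pattern {n : ℕ} (z : Fin n → ℝ) (x : S2) : ℝ :=
  (-1) ^ ((Finset.univ.filter fun k => z k ≤ (x : E3) 2).card + 1)

/-- The axisymmetric pattern with interfaces `z` is a critical point of `E_γ` under the mass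
constraint, with respect to one-dimensional perturbations in the height variable: its mean is `m`,
and the energy is stationary at `t = 0` along every smooth motion `t ↦ ζ t` of the interfaces that
starts at `z` and keeps the mean equal to `m`. -/
structure IsAxisymmetricCritical {n : ℕ} (γ m : ℝ) (z : Fin n → ℝ) : Prop where
  interfaces : IsInterfaces z
  mass_eq : mass (pattern z) = m
  stationary : ∀ ζ : ℝ → Fin n → ℝ, ContDiff ℝ ∞ ζ → ζ 0 = z →
    (∀ᶠ t in 𝓝 (0 : ℝ), mass (pattern (ζ t)) = m) →
    HasDerivAt (fun t => energy γ m (pattern (ζ t))) 0 0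

/-! ### Geodesic curvature of the boundary of a region of the sphere -/

/-- Near `x`, the boundary of `A` contains the curve `c`, parametrized by arc length, with
`c 0 = x`; and `ν` is the unit normal to `c` at `x`, tangent to `𝕊²`, that points out of `A`: the
great circle through `x` with velocity `ν` leaves `A` there. -/
structure IsBoundaryCurve (A : Set S2) (x : S2) (c : ℝ → S2) (ν : E3) : Prop where
  smooth : ContDiffAt ℝ 2 (fun s => (c s : E3)) 0
  start : c 0 = x
  mem_boundary : ∀ᶠ s in 𝓝 (0 : ℝ), c s ∈ frontier A
  unit_speed : ∀ᶠ s in 𝓝 (0 : ℝ), ‖deriv (fun s => (c s : E3)) s‖ = 1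
  norm_normal : ‖ν‖ = 1
  normal_tangent : ⟪ν, (x : E3)⟫ = 0
  normal_orthogonal : ⟪ν, deriv (fun s => (c s : E3)) 0⟫ = 0
  outside : ∀ᶠ s in 𝓝[>] (0 : ℝ),
    Real.cos s • (x : E3) + Real.sin s • ν ∉ (Subtype.val '' A : Set E3)
  inside : ∀ᶠ s in 𝓝[<] (0 : ℝ),
    Real.cos s • (x : E3) + Real.sin s • ν ∈ (Subtype.val '' A : Set E3)

/-- `κ` is the signed geodesic curvature of `∂A` at `x` with respect to the outer normal `ν` of `A`,
that is, `κ = -⟨c'', ν⟩` for an arc-length parametrization `c` of `∂A` near `x`. With this sign it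
is the divergence of `ν`, and it is positive for a cap smaller than a hemisphere. -/
def IsGeodesicCurvature (A : Set S2) (x : S2) (κ : ℝ) : Prop :=
  (∃ c ν, IsBoundaryCurve A x c ν) ∧
    ∀ c ν, IsBoundaryCurve A x c ν →
      κ = -⟪deriv (deriv fun s => (c s : E3)) 0, ν⟫

end

end SphereOK

/-! By rotational symmetry the curvature of $\partial A$ and the potential of the pattern are
constant on each interface circle, so the Euler–Lagrange equation only says that the $n$ numbers
$(-1)^k z_k/\sqrt{1-z_k^2}+4\gamma V(z_k)$ coincide (`k` counted from 0), where $V$ is an explicit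
potential in the height. The mean is affine in the interfaces, so speeds $w$ with $\sum(-1)^k w_k=0$
preserve it, and along them the energy has derivative $-2\pi\sum(-1)^k w_k\,(\text{number}_k)$
(`hasDerivAt_energy_line`). Moving only two interfaces shows that their numbers agree
(`exists_multiplier`).

Most of the work evaluates the energy. The divergence theorem on the sphere
(`integral_inner_sphereGrad`) gives the uniform distribution of the height (`map_height_area`) and
integration by parts against functions of the height (`integral_height_ibp`). A pattern is an
alternating sum of caps. Its total variation follows by bounding the flux of a field through each
circle and exhibiting an optimal field (`totalVariation_pattern`); its potential is the same sum of
explicit cap potentials (`isPoissonSolution_pattern`).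

The potential need not be differentiated in the interfaces: symmetry of the weak equation turns the
change of Dirichlet energy into integrals of $V'+V$ (new plus old profile) over the short intervals
swept by the interfaces (`dirichlet_pattern_sub`), and there continuity suffices. The geometric half
identifies $\partial A$ with the parallels and shows that every admissible boundary curve has the
stated curvature (`isGeodesicCurvature_pattern`). A general solution differs from $V$ by a constant,
which only shifts $\lambda$. -/

namespace SphereOK

/-! ### Calculus of radial extensions and tangential gradients. -/

section Basics

instance : IsFiniteMeasure area := by unfold area; infer_instance

instance : area.IsOpenPosMeasure := by unfold area; infer_instance

lemma S2.norm_coe (x : S2) : ‖(x : E3)‖ = 1 := by simp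

lemma S2.ne_zero (x : S2) : (x : E3) ≠ 0 := by
  intro h; have := S2.norm_coe x; simp [h] at this

lemma S2.inner_self (x : S2) : ⟪(x : E3), (x : E3)⟫ = 1 := by
  rw [real_inner_self_eq_norm_sq, S2.norm_coe]; norm_num

/-- The radial projection of a nonzero vector to the sphere. -/
noncomputable def proj (y : E3) (hy : y ≠ 0) : S2 :=
  ⟨‖y‖⁻¹ • y, by simp [norm_smul, hy]⟩

lemma radialExt_of_ne (f : S2 → ℝ) {y : E3} (hy : y ≠ 0) : radialExt f y = f (proj y hy) :=
  Subtype.val_injective.extend_apply f 0 (proj y hy)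

lemma radialExt_coe (f : S2 → ℝ) (x : S2) : radialExt f x = f x := by
  rw [radialExt_of_ne f x.ne_zero]
  congr 1
  ext1
  simp [proj]

lemma radialExt_smul (f : S2 → ℝ) {c : ℝ} (hc : 0 < c) (y : E3) :
    radialExt f (c • y) = radialExt f y := by
  unfold radialExt
  congr 1
  rw [norm_smul, Real.norm_of_nonneg hc.le, smul_smul, mul_inv, mul_comm c⁻¹, mul_assoc,
    inv_mul_cancel₀ hc.ne', mul_one]

lemma isOpen_punctured : IsOpen ({0}ᶜ : Set E3) := isOpen_compl_singleton

lemma IsC1.differentiableAt {f : S2 → ℝ} (hf : IsC1 f) {y : E3} (hy : y ≠ 0) :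
    DifferentiableAt ℝ (radialExt f) y :=
  (ContDiffOn.contDiffAt hf (isOpen_punctured.mem_nhds hy)).differentiableAt one_ne_zero

lemma IsC1.continuousOn_fderiv {f : S2 → ℝ} (hf : IsC1 f) :
    ContinuousOn (fderiv ℝ (radialExt f)) {0}ᶜ :=
  ContDiffOn.continuousOn_fderiv_of_isOpen hf isOpen_punctured le_rfl

lemma inner_sphereGrad (f : S2 → ℝ) (x : S2) (e : E3) :
    ⟪sphereGrad f x, e⟫ = fderiv ℝ (radialExt f) x e := by
  simp [sphereGrad, gradient]

lemma fderiv_radialExt_smul {f : S2 → ℝ} {c : ℝ} (hc : 0 < c) (y : E3) :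
    fderiv ℝ (radialExt f) (c • y) = c⁻¹ • fderiv ℝ (radialExt f) y := by
  have h : (fun y => radialExt f (c • y)) = radialExt f := funext (radialExt_smul f hc)
  have h2 := fderiv_comp_smul (𝕜 := ℝ) (f := radialExt f) (x := y) c
  rw [h] at h2
  rw [h2, smul_smul, inv_mul_cancel₀ hc.ne', one_smul]

/-- The extension is constant along the ray through `x`, so its derivative in the direction `x` is
zero. -/
lemma IsC1.inner_sphereGrad_self {f : S2 → ℝ} (hf : IsC1 f) (x : S2) :
    ⟪sphereGrad f x, (x : E3)⟫ = 0 := by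
  rw [inner_sphereGrad]
  have h1 : HasDerivAt (fun t : ℝ => (1 + t) • (x : E3)) (x : E3) 0 := by
    simpa using ((hasDerivAt_id (0 : ℝ)).const_add 1).smul_const (x : E3)
  have h2 : HasFDerivAt (radialExt f) (fderiv ℝ (radialExt f) x) ((1 + (0 : ℝ)) • (x : E3)) := by
    simpa using (hf.differentiableAt x.ne_zero).hasFDerivAt
  have h3 := h2.comp_hasDerivAt 0 h1
  have h4 : HasDerivAt (radialExt f ∘ fun t : ℝ => (1 + t) • (x : E3)) 0 0 := by
    refine (hasDerivAt_const (0 : ℝ) (radialExt f x)).congr_of_eventuallyEq ?_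
    filter_upwards [lt_mem_nhds (show (-1 : ℝ) < 0 by norm_num)] with t ht
    exact radialExt_smul f (by linarith) _
  exact h3.unique h4

lemma IsC1.continuous_sphereGrad {f : S2 → ℝ} (hf : IsC1 f) : Continuous (sphereGrad f) := by
  have h : Continuous fun x : S2 => fderiv ℝ (radialExt f) (x : E3) :=
    hf.continuousOn_fderiv.comp_continuous continuous_subtype_val fun x => x.ne_zero
  exact (InnerProductSpace.toDual ℝ E3).symm.continuous.comp h

lemma IsC1.continuous {f : S2 → ℝ} (hf : IsC1 f) : Continuous f := by
  have h : Continuous fun x : S2 => radialExt f (x : E3) :=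
    (ContDiffOn.continuousOn hf).comp_continuous continuous_subtype_val fun x => x.ne_zero
  simpa only [radialExt_coe] using h

lemma isC1_congr {f : S2 → ℝ} {g : E3 → ℝ} (hg : ContDiffOn ℝ 1 g {0}ᶜ)
    (h : ∀ y, ∀ hy : y ≠ 0, f (proj y hy) = g y) : IsC1 f :=
  ContDiffOn.congr hg fun y hy => (radialExt_of_ne f hy).trans (h y hy)

lemma IsC1.add {f g : S2 → ℝ} (hf : IsC1 f) (hg : IsC1 g) : IsC1 fun x => f x + g x :=
  isC1_congr (ContDiffOn.add hf hg) fun y hy => by simp [radialExt_of_ne, hy]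

lemma IsC1.mul {f g : S2 → ℝ} (hf : IsC1 f) (hg : IsC1 g) : IsC1 fun x => f x * g x :=
  isC1_congr (ContDiffOn.mul hf hg) fun y hy => by simp [radialExt_of_ne, hy]

lemma isC1_const (c : ℝ) : IsC1 fun _ => c :=
  isC1_congr (g := fun _ => c) contDiffOn_const fun _ _ => rfl

lemma IsC1.const_mul {f : S2 → ℝ} (hf : IsC1 f) (c : ℝ) : IsC1 fun x => c * f x :=
  (isC1_const c).mul hf

lemma IsC1.sub {f g : S2 → ℝ} (hf : IsC1 f) (hg : IsC1 g) : IsC1 fun x => f x - g x := by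
  simpa [sub_eq_add_neg] using hf.add (hg.const_mul (-1))

lemma contDiffOn_normalize : ContDiffOn ℝ 1 (fun y : E3 => ‖y‖⁻¹ • y) {0}ᶜ := by
  intro y hy
  have : ContDiffAt ℝ 1 (fun y : E3 => ‖y‖) y := contDiffAt_norm ℝ hy
  exact ((this.inv (norm_ne_zero_iff.2 hy)).smul contDiffAt_id).contDiffWithinAt

lemma isC1_restrict {F : E3 → ℝ} (hF : ContDiff ℝ 1 F) : IsC1 fun x => F x :=
  isC1_congr (g := fun y => F (‖y‖⁻¹ • y)) (hF.comp_contDiffOn contDiffOn_normalize)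
    fun _ _ => rfl

lemma fderiv_radialExt_congr {f : S2 → ℝ} {g : E3 → ℝ} {x : S2}
    (h : ∀ y, ∀ hy : y ≠ 0, f (proj y hy) = g y) :
    fderiv ℝ (radialExt f) x = fderiv ℝ g x := by
  refine Filter.EventuallyEq.fderiv_eq ?_
  filter_upwards [isOpen_punctured.mem_nhds x.ne_zero] with y hy
  exact (radialExt_of_ne f hy).trans (h y hy)

lemma sphereGrad_congr {f : S2 → ℝ} {g : E3 → ℝ} {x : S2}
    (h : ∀ y, ∀ hy : y ≠ 0, f (proj y hy) = g y) :
    sphereGrad f x = gradient g x := by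
  rw [sphereGrad, gradient, fderiv_radialExt_congr h, gradient]

lemma sphereGrad_add {f g : S2 → ℝ} (hf : IsC1 f) (hg : IsC1 g) (x : S2) :
    sphereGrad (fun x => f x + g x) x = sphereGrad f x + sphereGrad g x := by
  rw [sphereGrad_congr (g := fun y => radialExt f y + radialExt g y)
    fun y hy => by simp [radialExt_of_ne, hy]]
  simp [sphereGrad, gradient, fderiv_fun_add (hf.differentiableAt x.ne_zero)
    (hg.differentiableAt x.ne_zero)]

lemma sphereGrad_mul {f g : S2 → ℝ} (hf : IsC1 f) (hg : IsC1 g) (x : S2) :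
    sphereGrad (fun x => f x * g x) x = f x • sphereGrad g x + g x • sphereGrad f x := by
  rw [sphereGrad_congr (g := fun y => radialExt f y * radialExt g y)
    fun y hy => by simp [radialExt_of_ne, hy]]
  simp [sphereGrad, gradient, fderiv_fun_mul (hf.differentiableAt x.ne_zero)
    (hg.differentiableAt x.ne_zero), radialExt_coe]

lemma sphereGrad_const (c : ℝ) (x : S2) : sphereGrad (fun _ => c) x = 0 := by
  rw [sphereGrad_congr (g := fun _ => c) fun y hy => rfl]
  simp [gradient]

lemma sphereGrad_const_mul {f : S2 → ℝ} (hf : IsC1 f) (c : ℝ) (x : S2) :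
    sphereGrad (fun x => c * f x) x = c • sphereGrad f x := by
  rw [sphereGrad_mul (isC1_const c) hf, sphereGrad_const]; simp

lemma sphereGrad_sub {f g : S2 → ℝ} (hf : IsC1 f) (hg : IsC1 g) (x : S2) :
    sphereGrad (fun x => f x - g x) x = sphereGrad f x - sphereGrad g x := by
  have := sphereGrad_add hf (hg.const_mul (-1)) x
  rw [sphereGrad_const_mul hg] at this
  simpa [sub_eq_add_neg] using this

lemma hasFDerivAt_normalize (x : S2) : HasFDerivAt (fun y : E3 => ‖y‖⁻¹ • y)
    (ContinuousLinearMap.id ℝ E3 - (innerSL ℝ (x : E3)).smulRight (x : E3)) (x : E3) := by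
  have h0 : DifferentiableAt ℝ (fun y : E3 => ‖y‖⁻¹ • y) x :=
    (contDiffOn_normalize.contDiffAt (isOpen_punctured.mem_nhds x.ne_zero)).differentiableAt
      one_ne_zero
  have h1 : HasFDerivAt (fun y : E3 => ‖y‖) (innerSL ℝ (x : E3)) (x : E3) := by
    have := (hasStrictFDerivAt_norm_sq (x : E3)).hasFDerivAt.sqrt
      (by simp)
    simp only [Real.sqrt_sq (norm_nonneg _), S2.norm_coe] at this
    refine this.congr_fderiv ?_
    ext1 v
    simp
  have h2 : HasFDerivAt (fun y : E3 => ‖y‖⁻¹) (-(innerSL ℝ (x : E3))) (x : E3) := by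
    refine ((hasDerivAt_inv (x := ‖(x : E3)‖) (by simp)).comp_hasFDerivAt (x : E3) h1).congr_fderiv
      ?_
    simp
  have h3 := h2.smul (hasFDerivAt_id (x : E3))
  refine h3.congr_fderiv ?_
  ext1 v
  simp [sub_eq_add_neg]

/-- Chain rule through `y ↦ y / ‖y‖`, whose derivative at a point of the sphere is the orthogonal
projection to the tangent plane. -/
lemma inner_sphereGrad_restrict {F : E3 → ℝ} (hF : ContDiff ℝ 1 F) (x : S2) (e : E3) :
    ⟪sphereGrad (fun x => F x) x, e⟫ = fderiv ℝ F x (e - ⟪(x : E3), e⟫ • (x : E3)) := by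
  rw [inner_sphereGrad, fderiv_radialExt_congr (g := fun y => F (‖y‖⁻¹ • y)) fun y hy => rfl]
  have h : HasFDerivAt F (fderiv ℝ F x) (‖(x : E3)‖⁻¹ • (x : E3)) := by
    simpa using (hF.differentiable one_ne_zero _).hasFDerivAt
  have := HasFDerivAt.comp (f := fun y : E3 => ‖y‖⁻¹ • y) (x : E3) h (hasFDerivAt_normalize x)
  rw [show (fun y => F (‖y‖⁻¹ • y)) = F ∘ fun y => ‖y‖⁻¹ • y from rfl, this.fderiv]
  simp

/-- The upward unit vector, dual to the height variable. -/
noncomputable def e3 : E3 := EuclideanSpace.single 2 1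

lemma inner_e3 (y : E3) : ⟪y, e3⟫ = y 2 := by
  rw [e3, EuclideanSpace.inner_single_right]; simp

lemma e3_inner (y : E3) : ⟪e3, y⟫ = y 2 := by rw [real_inner_comm, inner_e3]

lemma norm_sq_coords (y : E3) : ‖y‖ ^ 2 = y 0 ^ 2 + y 1 ^ 2 + y 2 ^ 2 := by
  simp [EuclideanSpace.norm_sq_eq, Fin.sum_univ_three]

lemma S2.coords (x : S2) : (x : E3) 0 ^ 2 + (x : E3) 1 ^ 2 + (x : E3) 2 ^ 2 = 1 := by
  rw [← norm_sq_coords, S2.norm_coe]; norm_num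

lemma S2.height_mem (x : S2) : (x : E3) 2 ∈ Set.Icc (-1 : ℝ) 1 := by
  have := S2.coords x
  constructor <;> nlinarith [sq_nonneg ((x : E3) 0), sq_nonneg ((x : E3) 1)]

lemma continuous_height : Continuous fun x : S2 => (x : E3) 2 := by fun_prop

lemma contDiff_height {n : WithTop ℕ∞} : ContDiff ℝ n fun y : E3 => y 2 := by fun_prop

lemma isC1_height_comp {q : ℝ → ℝ} (hq : ContDiff ℝ 1 q) : IsC1 fun x => q ((x : E3) 2) :=
  isC1_restrict (F := fun y => q (y 2)) (hq.comp contDiff_height)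

lemma hasFDerivAt_height (y : E3) : HasFDerivAt (fun y : E3 => y 2) (innerSL ℝ e3) y := by
  have : (fun y : E3 => y 2) = innerSL ℝ e3 := by ext y; simp [e3_inner]
  rw [this]; exact (innerSL ℝ e3).hasFDerivAt

lemma sphereGrad_height_comp {q : ℝ → ℝ} (hq : ContDiff ℝ 1 q) (x : S2) :
    sphereGrad (fun x => q ((x : E3) 2)) x
      = deriv q ((x : E3) 2) • (e3 - (x : E3) 2 • (x : E3)) := by
  refine ext_inner_right ℝ fun e => ?_
  rw [inner_sphereGrad_restrict (F := fun y => q (y 2)) (hq.comp contDiff_height)]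
  have h := ((hq.differentiable one_ne_zero ((x : E3) 2)).hasDerivAt).comp_hasFDerivAt (x : E3)
    (hasFDerivAt_height x)
  rw [show (fun y : E3 => q (y 2)) = q ∘ fun y => y 2 from rfl, h.fderiv]
  simp [inner_smul_left, inner_sub_left, e3_inner, inner_sub_right, inner_smul_right]
  left; ring

end Basics

/-! ### The divergence theorem on the sphere. -/

section DivergenceTheorem

/-- Integration in polar coordinates of a product of a radial and a homogeneous function. -/
lemma integral_radial_mul (k : ℝ → ℝ) (H : S2 → ℝ) :
    ∫ y : E3, k ‖y‖ * radialExt H y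
      = (∫ x, H x ∂area) * ∫ r in Set.Ioi (0 : ℝ), r ^ 2 * k r := by
  calc ∫ y : E3, k ‖y‖ * radialExt H y
      = ∫ y : ({(0 : E3)}ᶜ : Set E3), k ‖y.1‖ * radialExt H y.1
          ∂((volume : Measure E3).comap (↑)) := by
        rw [integral_subtype_comap (measurableSet_singleton _).compl
          fun y => k ‖y‖ * radialExt H y, restrict_compl_singleton]
    _ = ∫ p, H p.1 * k p.2.1
          ∂((volume : Measure E3).toSphere.prod (.volumeIoiPow (Module.finrank ℝ E3 - 1))) := by
        rw [← (volume : Measure E3).measurePreserving_homeomorphUnitSphereProd.integral_comp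
          (Homeomorph.measurableEmbedding _)]
        congr 1
        ext y
        have h1 : (homeomorphUnitSphereProd E3 y).1 = proj y y.2 :=
          Subtype.ext (by simp [proj])
        have h2 : ((homeomorphUnitSphereProd E3 y).2 : ℝ) = ‖(y : E3)‖ := by simp
        rw [radialExt_of_ne H y.2, mul_comm, h1, h2]
    _ = (∫ x, H x ∂area) * ∫ r : Set.Ioi (0 : ℝ), k r ∂(.volumeIoiPow 2) := by
        rw [integral_prod_mul (fun x => H x) (fun r : Set.Ioi (0 : ℝ) => k r)]
        simp [area]
    _ = _ := by
        congr 1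
        simp only [Measure.volumeIoiPow, ENNReal.ofReal]
        rw [integral_withDensity_eq_integral_smul,
          integral_subtype_comap measurableSet_Ioi fun a => Real.toNNReal (a ^ 2) • k a,
          setIntegral_congr_fun measurableSet_Ioi fun x hx => ?_]
        · rw [NNReal.smul_def, Real.coe_toNNReal _ (by positivity), smul_eq_mul]
        · exact (measurable_subtype_coe.pow_const _).real_toNNReal

/-- A bump function supported in `(1, 3)`. -/
noncomputable def radialBump : ContDiffBump (2 : ℝ) := ⟨1 / 2, 1, by norm_num, by norm_num⟩

lemma radialBump_eq_zero {r : ℝ} (hr : r ≤ 1) : radialBump r = 0 := by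
  refine radialBump.zero_of_le_dist ?_
  rw [Real.dist_eq, abs_of_nonpos (by linarith)]
  show (1 : ℝ) ≤ _
  linarith

lemma deriv_radialBump_eq_zero {r : ℝ} (hr : r < 1) : deriv radialBump r = 0 := by
  have : radialBump =ᶠ[𝓝 r] fun _ => (0 : ℝ) := by
    filter_upwards [gt_mem_nhds hr] with s hs using radialBump_eq_zero hs.le
  rw [this.deriv_eq]; simp

lemma integral_radialBump_pos : 0 < ∫ r, r * radialBump r := by
  refine Continuous.integral_pos_of_hasCompactSupport_nonneg_nonzero (x := 2) ?_ ?_ ?_ ?_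
  · exact continuous_id.mul radialBump.continuous
  · exact radialBump.hasCompactSupport.mul_left
  · intro r
    rcases le_total r 1 with h | h
    · simp [radialBump_eq_zero h]
    · exact mul_nonneg (by linarith) radialBump.nonneg
  · have : radialBump (2 : ℝ) = 1 := radialBump.one_of_mem_closedBall (by simp [radialBump])
    simp [this]

/-- Integration by parts on the line. The factor 2 that it produces is the one in
`integral_inner_sphereGrad`. -/
lemma integral_sq_mul_deriv_radialBump :
    ∫ r, r ^ 2 * deriv radialBump r = -(2 * ∫ r, r * radialBump r) := by
  have hd : Continuous (deriv radialBump) :=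
    (radialBump.contDiff (n := 1)).continuous_deriv le_rfl
  have hc : HasCompactSupport radialBump := radialBump.hasCompactSupport
  have h := integral_mul_deriv_eq_deriv_mul_of_integrable (u := fun r : ℝ => r ^ 2)
    (v := radialBump) (u' := fun r => 2 * r) (v' := deriv radialBump)
    (fun r _ => by simpa using hasDerivAt_pow 2 r)
    (fun r _ => ((radialBump.contDiff (n := 1)).differentiable one_ne_zero r).hasDerivAt)
    (Continuous.integrable_of_hasCompactSupport (by fun_prop) hc.deriv.mul_left)
    (Continuous.integrable_of_hasCompactSupport
      ((by fun_prop : Continuous fun r : ℝ => 2 * r).mul radialBump.continuous) hc.mul_left)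
    (Continuous.integrable_of_hasCompactSupport
      ((by fun_prop : Continuous fun r : ℝ => r ^ 2).mul radialBump.continuous) hc.mul_left)
  rw [h, ← integral_const_mul]
  simp only [mul_assoc]

/-- The bump function as a radial function on the space. -/
noncomputable def radialCutoff (y : E3) : ℝ := radialBump ‖y‖

lemma radialCutoff_eventually_zero : radialCutoff =ᶠ[𝓝 0] fun _ => 0 := by
  filter_upwards [Metric.ball_mem_nhds (0 : E3) one_pos] with y hy
  exact radialBump_eq_zero (mem_ball_zero_iff.1 hy).le

lemma contDiff_radialCutoff : ContDiff ℝ 1 radialCutoff := by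
  rw [contDiff_iff_contDiffAt]
  intro y
  by_cases hy : y = 0
  · subst hy
    exact contDiffAt_const.congr_of_eventuallyEq radialCutoff_eventually_zero
  · exact radialBump.contDiffAt.comp y (contDiffAt_norm ℝ hy)

lemma hasCompactSupport_radialCutoff : HasCompactSupport radialCutoff := by
  refine HasCompactSupport.of_support_subset_isCompact (isCompact_closedBall (0 : E3) 3) ?_
  intro y hy
  by_contra h
  refine hy (radialBump.zero_of_le_dist ?_)
  rw [mem_closedBall_zero_iff, not_le] at h
  rw [Real.dist_eq, abs_of_nonneg (by linarith)]
  show (1 : ℝ) ≤ _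
  linarith

lemma ne_zero_of_mem_tsupport_radialCutoff {y : E3} (hy : y ∈ tsupport radialCutoff) : y ≠ 0 := by
  rintro rfl
  exact (notMem_tsupport_iff_eventuallyEq.2 radialCutoff_eventually_zero) hy

lemma fderiv_radialCutoff {y : E3} (hy : y ≠ 0) (e : E3) :
    fderiv ℝ radialCutoff y e
      = deriv radialBump ‖y‖ * radialExt (fun x : S2 => ⟪(x : E3), e⟫) y := by
  have h1 : HasFDerivAt (fun y : E3 => ‖y‖) (‖y‖⁻¹ • innerSL ℝ y) y := by
    have := (hasStrictFDerivAt_norm_sq y).hasFDerivAt.sqrt (by simpa using hy)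
    simp only [Real.sqrt_sq (norm_nonneg _)] at this
    refine this.congr_fderiv ?_
    ext1 v
    simp
    field_simp
  have h2 := (((radialBump.contDiff (n := 1)).differentiable one_ne_zero
    ‖y‖).hasDerivAt).comp_hasFDerivAt y h1
  rw [show radialCutoff = radialBump ∘ fun y : E3 => ‖y‖ from rfl, h2.fderiv,
    radialExt_of_ne _ hy]
  simp [proj, inner_smul_left]

lemma IsC1.fderiv_radialExt {f : S2 → ℝ} {y : E3} (hy : y ≠ 0) (e : E3) :
    fderiv ℝ (radialExt f) y e = ‖y‖⁻¹ * radialExt (fun x => ⟪sphereGrad f x, e⟫) y := by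
  have h : y = ‖y‖ • (proj y hy : E3) := by
    simp [proj, smul_smul, hy]
  rw [radialExt_of_ne _ hy, inner_sphereGrad]
  conv_lhs => rw [h, fderiv_radialExt_smul (norm_pos_iff.2 hy)]
  simp

/-- A radial extension may be singular at the origin, but the cutoff vanishes near it. -/
lemma continuous_cutoff_mul {g : E3 → ℝ} (hg : ContinuousOn g {0}ᶜ) {k : E3 → ℝ}
    (hk : Continuous k) (hs : tsupport k ⊆ tsupport radialCutoff) :
    Continuous fun y => k y * g y := by
  refine continuous_of_tsupport fun y hy => ?_
  have hy0 : y ≠ 0 :=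
    ne_zero_of_mem_tsupport_radialCutoff (hs (tsupport_mul_subset_left hy))
  exact hk.continuousAt.mul (hg.continuousAt (isOpen_punctured.mem_nhds hy0))

/-- The divergence theorem on the sphere for constant vector fields. -/
theorem integral_inner_sphereGrad {f : S2 → ℝ} (hf : IsC1 f) (e : E3) :
    ∫ x, ⟪sphereGrad f x, e⟫ ∂area = 2 * ∫ x, f x * ⟪(x : E3), e⟫ ∂area := by
  have hcs := hasCompactSupport_radialCutoff
  have hfd : Continuous fun y => fderiv ℝ radialCutoff y e :=
    (contDiff_radialCutoff.continuous_fderiv one_ne_zero).clm_apply continuous_const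
  have hsub : tsupport (fun y => fderiv ℝ radialCutoff y e) ⊆ tsupport radialCutoff :=
    tsupport_fderiv_apply_subset ℝ e
  -- Euclidean integration by parts of the cutoff against the extension of `f`. In polar coordinates
  -- each side is a spherical integral times a radial one; the radial factors are `∫ r * radialBump
  -- r` and `-2` times it, and this positive number cancels.
  have h := integral_mul_fderiv_eq_neg_fderiv_mul_of_integrable (μ := (volume : Measure E3))
    (f := radialCutoff) (g := radialExt f) (v := e)
    ((continuous_cutoff_mul (ContDiffOn.continuousOn hf) hfd hsub).integrable_of_hasCompactSupport
      ((hcs.fderiv_apply ℝ e).mul_right))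
    ((continuous_cutoff_mul (hf.continuousOn_fderiv.clm_apply continuousOn_const)
      contDiff_radialCutoff.continuous subset_rfl).integrable_of_hasCompactSupport hcs.mul_right)
    ((continuous_cutoff_mul (ContDiffOn.continuousOn hf)
      contDiff_radialCutoff.continuous subset_rfl).integrable_of_hasCompactSupport hcs.mul_right)
    (fun y _ => contDiff_radialCutoff.differentiable one_ne_zero y)
    (fun y hy => hf.differentiableAt (ne_zero_of_mem_tsupport_radialCutoff hy))
  have hae : ∀ᵐ y : E3, y ≠ 0 := by
    simp [ae_iff]
  have hl : ∫ y, radialCutoff y * fderiv ℝ (radialExt f) y e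
      = (∫ x, ⟪sphereGrad f x, e⟫ ∂area) * ∫ r, r * radialBump r := by
    rw [← setIntegral_eq_integral_of_forall_compl_eq_zero (s := Set.Ioi (0 : ℝ))
      (f := fun r => r * radialBump r) (fun r hr => by
        rw [radialBump_eq_zero (by simp at hr; linarith), mul_zero])]
    rw [setIntegral_congr_fun (g := fun r => r ^ 2 * (radialBump r * r⁻¹)) measurableSet_Ioi
      (fun r (hr : 0 < r) => by field_simp),
      ← integral_radial_mul (fun r => radialBump r * r⁻¹)]
    refine integral_congr_ae ?_
    filter_upwards [hae] with y hy
    rw [IsC1.fderiv_radialExt hy, radialCutoff, mul_assoc]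
  have hr : ∫ y, fderiv ℝ radialCutoff y e * radialExt f y
      = (∫ x, f x * ⟪(x : E3), e⟫ ∂area) * -(2 * ∫ r, r * radialBump r) := by
    rw [← integral_sq_mul_deriv_radialBump,
      ← setIntegral_eq_integral_of_forall_compl_eq_zero (s := Set.Ioi (0 : ℝ))
      (f := fun r => r ^ 2 * deriv radialBump r) (fun r hr => by
        rw [deriv_radialBump_eq_zero (by simp at hr; linarith), mul_zero]),
      ← integral_radial_mul (deriv radialBump)]
    refine integral_congr_ae ?_
    filter_upwards [hae] with y hy
    rw [fderiv_radialCutoff hy, mul_assoc]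
    simp only [radialExt_of_ne _ hy]
    rw [mul_comm (⟪_, _⟫)]
  rw [hl, hr] at h
  have hpos := integral_radialBump_pos
  refine mul_right_cancel₀ hpos.ne' ?_
  linarith

end DivergenceTheorem

/-! ### The distribution of the height on the sphere. -/

section Archimedes

lemma area_real_univ : area.real Set.univ = 4 * Real.pi := by
  rw [area, Measure.toSphere_real_apply_univ, measureReal_def, EuclideanSpace.volume_ball_fin_three]
  rw [ENNReal.toReal_mul, ENNReal.toReal_pow, ENNReal.toReal_ofReal zero_le_one,
    ENNReal.toReal_ofReal (by have := Real.pi_pos; positivity)]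
  simp
  ring

lemma integral_area_const (c : ℝ) : ∫ _, c ∂area = 4 * Real.pi * c := by
  rw [integral_const, area_real_univ, smul_eq_mul]

lemma integrable_of_continuous {f : S2 → ℝ} (hf : Continuous f) : Integrable f area :=
  hf.integrable_of_hasCompactSupport (HasCompactSupport.of_compactSpace f)

lemma integrable_height_of_continuous {f : ℝ → ℝ} (hf : Continuous f) :
    Integrable (fun x : S2 => f ((x : E3) 2)) area :=
  integrable_of_continuous (hf.comp continuous_height)

lemma integral_deriv_height {q : ℝ → ℝ} (hq : ContDiff ℝ 1 q) :
    ∫ x : S2, deriv q ((x : E3) 2) * (1 - (x : E3) 2 ^ 2) ∂area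
      = 2 * ∫ x : S2, q ((x : E3) 2) * (x : E3) 2 ∂area := by
  have h := integral_inner_sphereGrad (isC1_height_comp hq) e3
  simp only [inner_e3] at h
  rw [← h]
  congr 1
  ext x
  rw [sphereGrad_height_comp hq]
  have : e3 2 = 1 := by simp [e3]
  simp [this]
  left; ring

/-- The divergence theorem applied to a power of the height gives a two-step recursion for the
moments; the moments of Lebesgue measure on $[-1,1]$ satisfy the same one. -/
lemma integral_height_pow_succ (k : ℕ) :
    ((k : ℝ) + 3) * ∫ x : S2, (x : E3) 2 ^ (k + 2) ∂area
      = (k + 1) * ∫ x : S2, (x : E3) 2 ^ k ∂area := by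
  have h := integral_deriv_height (q := fun s => s ^ (k + 1)) (by fun_prop)
  have hc (j : ℕ) : Integrable (fun x : S2 => (x : E3) 2 ^ j) area :=
    integrable_of_continuous (continuous_height.pow j)
  have h1 : ∀ x : S2, deriv (fun s : ℝ => s ^ (k + 1)) ((x : E3) 2) * (1 - (x : E3) 2 ^ 2)
      = (k + 1) * (x : E3) 2 ^ k - (k + 1) * (x : E3) 2 ^ (k + 2) := by
    intro x; simp; ring
  have h2 : ∀ x : S2, (x : E3) 2 ^ (k + 1) * (x : E3) 2 = (x : E3) 2 ^ (k + 2) := by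
    intro x; ring
  simp only [h1, h2] at h
  rw [integral_sub ((hc k).const_mul _) ((hc (k + 2)).const_mul _), integral_const_mul,
    integral_const_mul] at h
  linarith

lemma integral_height_pow (k : ℕ) :
    ∫ x : S2, (x : E3) 2 ^ k ∂area = 2 * Real.pi * ∫ s in (-1 : ℝ)..1, s ^ k := by
  induction k using Nat.twoStepInduction with
  | zero => simp [area_real_univ]; ring
  | one =>
    have h := integral_deriv_height (q := fun _ => 1) contDiff_const
    simp at h
    simp [h]
  | more k ih _ =>
    have h := integral_height_pow_succ k
    rw [ih] at h
    simp only [integral_pow] at h ⊢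
    have hk : (k : ℝ) + 3 ≠ 0 := by positivity
    have hk' : (k : ℝ) + 1 ≠ 0 := by positivity
    refine mul_left_cancel₀ hk (h.trans ?_)
    push_cast
    rw [show (-1 : ℝ) ^ (k + 2 + 1) = (-1) ^ (k + 1) by ring]
    field_simp
    ring

lemma integral_height_polynomial (p : Polynomial ℝ) :
    ∫ x : S2, p.eval ((x : E3) 2) ∂area = 2 * Real.pi * ∫ s in (-1 : ℝ)..1, p.eval s := by
  induction p using Polynomial.induction_on' with
  | add p q hp hq =>
    simp only [Polynomial.eval_add]
    rw [integral_add (integrable_height_of_continuous p.continuous)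
      (integrable_height_of_continuous q.continuous),
      intervalIntegral.integral_add (p.continuous.intervalIntegrable _ _)
      (q.continuous.intervalIntegrable _ _), hp, hq]
    ring
  | monomial n a =>
    simp only [Polynomial.eval_monomial]
    rw [integral_const_mul, intervalIntegral.integral_const_mul, integral_height_pow]
    ring

lemma integral_height_continuous {f : ℝ → ℝ} (hf : Continuous f) :
    ∫ x : S2, f ((x : E3) 2) ∂area = 2 * Real.pi * ∫ s in (-1 : ℝ)..1, f s := by
  have hpi := Real.pi_pos
  refine eq_of_abs_sub_le_all fun ε hε => ?_
  -- Both sides are integrals of total mass `4π`, so a uniform error `ε / (8π)` costs `ε / 2` on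
  -- each.
  obtain ⟨p, hp⟩ := exists_polynomial_near_of_continuousOn (-1) 1 f hf.continuousOn
    (ε / (8 * Real.pi)) (by positivity)
  have h1 : |∫ x : S2, f ((x : E3) 2) ∂area - ∫ x : S2, p.eval ((x : E3) 2) ∂area|
      ≤ ε / (8 * Real.pi) * (4 * Real.pi) := by
    rw [← integral_sub (integrable_height_of_continuous hf)
      (integrable_height_of_continuous p.continuous), ← area_real_univ,
      ← Real.norm_eq_abs]
    refine norm_integral_le_of_norm_le_const (ae_of_all _ fun x => ?_)
    rw [norm_sub_rev]
    exact (hp _ x.height_mem).le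
  have h2 : |∫ s in (-1 : ℝ)..1, f s - p.eval s| ≤ ε / (8 * Real.pi) * |1 - -1| := by
    rw [← Real.norm_eq_abs]
    refine intervalIntegral.norm_integral_le_of_norm_le_const fun s hs => ?_
    rw [Set.uIoc_of_le (by norm_num)] at hs
    rw [norm_sub_rev]
    exact (hp _ ⟨hs.1.le, hs.2⟩).le
  rw [intervalIntegral.integral_sub (hf.intervalIntegrable _ _)
    (p.continuous.intervalIntegrable _ _)] at h2
  rw [integral_height_polynomial] at h1
  have e1 : ε / (8 * Real.pi) * (4 * Real.pi) = ε / 2 := by field_simp; norm_num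
  have e2 : ε / (8 * Real.pi) * |1 - -1| * (2 * Real.pi) = ε / 2 := by
    norm_num; field_simp; norm_num
  rw [e1] at h1
  have h3 := mul_le_mul_of_nonneg_right h2 (show 0 ≤ 2 * Real.pi by positivity)
  rw [e2] at h3
  rw [abs_le] at h1 ⊢
  have h4 : |(∫ s in (-1 : ℝ)..1, f s) - ∫ s in (-1 : ℝ)..1, p.eval s| * (2 * Real.pi)
    = |2 * Real.pi * (∫ s in (-1 : ℝ)..1, f s) - 2 * Real.pi * ∫ s in (-1 : ℝ)..1, p.eval s| := by
    rw [← mul_sub, abs_mul, abs_of_pos (show 0 < 2 * Real.pi by positivity), mul_comm]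
  rw [h4, abs_le] at h3
  constructor <;> linarith [h1.1, h1.2, h3.1, h3.2]

/-- **Archimedes' hat-box theorem**: the height is uniformly distributed. -/
theorem map_height_area : area.map (fun x : S2 => (x : E3) 2)
    = ENNReal.ofReal (2 * Real.pi) • volume.restrict (Set.Ioc (-1 : ℝ) 1) := by
  have hpi := Real.pi_pos
  have : IsFiniteMeasure (ENNReal.ofReal (2 * Real.pi) • volume.restrict (Set.Ioc (-1 : ℝ) 1)) :=
    Measure.smul_finite _ ENNReal.ofReal_ne_top
  refine ext_of_forall_integral_eq_of_IsFiniteMeasure fun f => ?_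
  rw [integral_map continuous_height.measurable.aemeasurable f.continuous.aestronglyMeasurable,
    integral_height_continuous f.continuous, integral_smul_measure,
    intervalIntegral.integral_of_le (by norm_num), ENNReal.toReal_ofReal (by positivity),
    smul_eq_mul]

lemma integral_height {f : ℝ → ℝ} (hf : AEStronglyMeasurable f (volume.restrict (Set.Ioc (-1) 1))) :
    ∫ x : S2, f ((x : E3) 2) ∂area = 2 * Real.pi * ∫ s in (-1 : ℝ)..1, f s := by
  have hpi := Real.pi_pos
  have hf' : AEStronglyMeasurable f (area.map (fun x : S2 => (x : E3) 2)) := by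
    rw [map_height_area]; exact hf.smul_measure _
  rw [← integral_map continuous_height.measurable.aemeasurable hf', map_height_area,
    integral_smul_measure, intervalIntegral.integral_of_le (by norm_num),
    ENNReal.toReal_ofReal (by positivity), smul_eq_mul]

lemma integrable_height {f : ℝ → ℝ} (hf : IntervalIntegrable f volume (-1) 1) :
    Integrable (fun x : S2 => f ((x : E3) 2)) area := by
  rw [intervalIntegrable_iff_integrableOn_Ioc_of_le (by norm_num)] at hf
  have hf' : Integrable f (area.map (fun x : S2 => (x : E3) 2)) := by
    rw [map_height_area]; exact hf.smul_measure ENNReal.ofReal_ne_top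
  exact hf'.comp_aemeasurable continuous_height.measurable.aemeasurable

end Archimedes

/-! ### Integration by parts in the height and concentration on a parallel. -/

section HeightIntegration

lemma exists_bound_of_continuous {f : S2 → ℝ} (hf : Continuous f) : ∃ C, 0 ≤ C ∧ ∀ x, |f x| ≤ C := by
  obtain ⟨C, hC⟩ := isCompact_univ.exists_bound_of_continuousOn hf.continuousOn
  exact ⟨max C 0, le_max_right _ _, fun x => (hC x trivial).trans (le_max_left _ _)⟩

lemma continuous_primitive_height {r : ℝ → ℝ} (hr : IntervalIntegrable r volume (-1) 1) :
    Continuous fun x : S2 => ∫ s in (-1 : ℝ)..(x : E3) 2, r s := by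
  refine (intervalIntegral.continuousOn_primitive_interval (a := -1) (b := 1) ?_).comp_continuous
    continuous_height fun x => ?_
  · rwa [Set.uIcc_of_le (by norm_num), ← intervalIntegrable_iff_integrableOn_Icc_of_le (by norm_num)]
  · rw [Set.uIcc_of_le (by norm_num)]; exact x.height_mem

lemma abs_integral_height_mul_le {f : S2 → ℝ} {C : ℝ} (hC : ∀ x, |f x| ≤ C)
    {r : ℝ → ℝ} (hr : IntervalIntegrable r volume (-1) 1) :
    |∫ x : S2, r ((x : E3) 2) * f x ∂area| ≤ C * (2 * Real.pi * ∫ s in (-1 : ℝ)..1, |r s|) := by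
  have hr' := hr.abs
  have hi := hr'
  rw [intervalIntegrable_iff_integrableOn_Ioc_of_le (by norm_num)] at hi
  rw [← integral_height hi.aestronglyMeasurable, ← integral_const_mul, ← Real.norm_eq_abs]
  refine norm_integral_le_of_norm_le ((integrable_height hr').const_mul C) (ae_of_all _ fun x => ?_)
  rw [Real.norm_eq_abs, abs_mul, mul_comm]
  exact mul_le_mul_of_nonneg_right (hC x) (abs_nonneg _)

lemma abs_primitive_le {r : ℝ → ℝ} (hr : IntervalIntegrable r volume (-1) 1) {h : ℝ}
    (hh : h ∈ Set.Icc (-1 : ℝ) 1) :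
    |∫ s in (-1 : ℝ)..h, r s| ≤ ∫ s in (-1 : ℝ)..1, |r s| := by
  refine (intervalIntegral.abs_integral_le_integral_abs hh.1).trans ?_
  exact intervalIntegral.integral_mono_interval le_rfl hh.1 hh.2
    (ae_of_all _ fun s => abs_nonneg _) hr.abs

lemma intervalIntegrable_bounded_mul {f : S2 → ℝ} (hf : Continuous f)
    {r : ℝ → ℝ} (hr : IntervalIntegrable r volume (-1) 1) :
    Integrable (fun x : S2 => r ((x : E3) 2) * f x) area := by
  obtain ⟨C, -, hC⟩ := exists_bound_of_continuous hf
  exact (integrable_height hr).mul_bdd (c := C) hf.aestronglyMeasurable (ae_of_all _ hC)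

/-- An integration by parts formula in the height variable extends from continuously
differentiable to absolutely continuous functions of the height. -/
theorem integral_height_ibp {f g : S2 → ℝ} (hf : Continuous f) (hg : Continuous g)
    (H : ∀ q : ℝ → ℝ, ContDiff ℝ 1 q →
      ∫ x : S2, deriv q ((x : E3) 2) * f x ∂area = ∫ x : S2, q ((x : E3) 2) * g x ∂area)
    {r : ℝ → ℝ} (hr : IntervalIntegrable r volume (-1) 1) (c : ℝ) :
    ∫ x : S2, r ((x : E3) 2) * f x ∂area
      = ∫ x : S2, (c + ∫ s in (-1 : ℝ)..(x : E3) 2, r s) * g x ∂area := by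
  have hpi := Real.pi_pos
  obtain ⟨Cf, hCf0, hCf⟩ := exists_bound_of_continuous hf
  obtain ⟨Cg, hCg0, hCg⟩ := exists_bound_of_continuous hg
  refine eq_of_abs_sub_le_all fun ε hε => ?_
  set K := Cf * (2 * Real.pi) + Cg * (4 * Real.pi) + 1 with hK
  have hKpos : 0 < K := by positivity
  have hr1 := hr
  rw [intervalIntegrable_iff_integrableOn_Ioc_of_le (by norm_num)] at hr1
  -- Approximate `r` in L¹ by a continuous `ρ`. Its primitive is C¹, so `H` applies to it, and the
  -- errors on the two sides add up to `(ε / K) * (K - 1)`.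
  obtain ⟨ρ, hρ, -⟩ := Integrable.exists_boundedContinuous_integral_sub_le hr1
    (show 0 < ε / K by positivity)
  rw [← intervalIntegral.integral_of_le (by norm_num)] at hρ
  have hρc : Continuous ρ := ρ.continuous
  have hρi : IntervalIntegrable ρ volume (-1) 1 := hρc.intervalIntegrable _ _
  have hd := hr.sub hρi
  set q : ℝ → ℝ := fun h => c + ∫ s in (-1 : ℝ)..h, ρ s with hq
  have hqd : ∀ h, HasDerivAt q (ρ h) h := fun h =>
    (intervalIntegral.integral_hasDerivAt_right (hρc.intervalIntegrable _ _)
      hρc.stronglyMeasurable.stronglyMeasurableAtFilter hρc.continuousAt).const_add c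
  have hq1 : ContDiff ℝ 1 q := by
    rw [contDiff_one_iff_deriv]
    refine ⟨fun h => (hqd h).differentiableAt, ?_⟩
    rwa [show deriv q = ρ from funext fun h => (hqd h).deriv]
  have hqq := H q hq1
  rw [show deriv q = ρ from funext fun h => (hqd h).deriv] at hqq
  have e1 := abs_integral_height_mul_le hCf hd
  have e2 : |∫ x : S2, ((c + ∫ s in (-1 : ℝ)..(x : E3) 2, r s) * g x
      - q ((x : E3) 2) * g x) ∂area| ≤ ε / K * Cg * (4 * Real.pi) := by
    rw [← Real.norm_eq_abs, ← area_real_univ]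
    refine norm_integral_le_of_norm_le_const (ae_of_all _ fun x => ?_)
    have hsub : Set.uIcc (-1 : ℝ) ((x : E3) 2) ⊆ Set.uIcc (-1 : ℝ) 1 := by
      rw [Set.uIcc_of_le x.height_mem.1, Set.uIcc_of_le (by norm_num)]
      exact Set.Icc_subset_Icc_right x.height_mem.2
    rw [← sub_mul, hq]
    simp only [add_sub_add_left_eq_sub]
    rw [← intervalIntegral.integral_sub (hr.mono_set hsub) (hρi.mono_set hsub), norm_mul]
    exact mul_le_mul ((abs_primitive_le hd x.height_mem).trans hρ) (hCg x) (norm_nonneg _)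
      (by positivity)
  rw [integral_sub] at e2
  rotate_left
  · exact integrable_of_continuous ((continuous_const.add (continuous_primitive_height hr)).mul hg)
  · exact integrable_of_continuous ((hq1.continuous.comp continuous_height).mul hg)
  have e3 : ∫ x : S2, (r ((x : E3) 2) - ρ ((x : E3) 2)) * f x ∂area
      = ∫ x : S2, r ((x : E3) 2) * f x ∂area - ∫ x : S2, ρ ((x : E3) 2) * f x ∂area := by
    simp only [sub_mul]
    exact integral_sub (intervalIntegrable_bounded_mul hf hr) (intervalIntegrable_bounded_mul hf hρi)
  rw [e3] at e1
  have e4 : Cf * (2 * Real.pi * ∫ s in (-1 : ℝ)..1, |r s - ρ s|)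
      ≤ Cf * (2 * Real.pi * (ε / K)) := by
    gcongr
    exact hρ
  have e5 : Cf * (2 * Real.pi * (ε / K)) + ε / K * Cg * (4 * Real.pi) ≤ ε := by
    have : Cf * (2 * Real.pi * (ε / K)) + ε / K * Cg * (4 * Real.pi) = ε / K * (K - 1) := by
      rw [hK]; ring
    rw [this, mul_sub, div_mul_cancel₀ _ hKpos.ne', mul_one]
    linarith [show 0 < ε / K by positivity]
  rw [hqq] at e1
  rw [abs_le] at e1 e2 ⊢
  constructor <;> linarith [e1.1, e1.2, e2.1, e2.2]

/-- The normalized indicator function of the interval `(a - ε, a]`. -/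
noncomputable def spike (a ε : ℝ) : ℝ → ℝ := (Set.Ioc (a - ε) a).indicator fun _ => ε⁻¹

lemma integrable_spike (a ε : ℝ) : Integrable (spike a ε) :=
  (integrable_indicator_iff measurableSet_Ioc).2 (by simp)

lemma spike_nonneg {a ε : ℝ} (hε : 0 < ε) (s : ℝ) : 0 ≤ spike a ε s :=
  Set.indicator_nonneg (fun _ _ => (inv_pos.2 hε).le) s

lemma primitive_spike {a ε h : ℝ} (ha : -1 ≤ a - ε) (hh : -1 ≤ h) :
    ∫ s in (-1 : ℝ)..h, spike a ε s = max (min h a - (a - ε)) 0 * ε⁻¹ := by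
  rw [intervalIntegral.integral_of_le hh, spike, setIntegral_indicator measurableSet_Ioc,
    setIntegral_const, Set.Ioc_inter_Ioc, Real.volume_real_Ioc]
  simp [ha]

/-- The primitive of the spike is a ramp rising from 0 to 1 on `[a - ε, a]`. After integration by
parts the ramps converge pointwise to the indicator of `[a, ∞)` and dominated convergence applies.
With the spike to the left of `a`, the limit is 1 at `a` itself, as in `pattern`. -/
lemma tendsto_integral_spike {f g : S2 → ℝ} (hf : Continuous f) (hg : Continuous g)
    (H : ∀ q : ℝ → ℝ, ContDiff ℝ 1 q →
      ∫ x : S2, deriv q ((x : E3) 2) * f x ∂area = ∫ x : S2, q ((x : E3) 2) * g x ∂area)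
    {a : ℝ} (ha : -1 < a) :
    Tendsto (fun ε => ∫ x : S2, spike a ε ((x : E3) 2) * f x ∂area) (𝓝[>] 0)
      (𝓝 (∫ x : S2, (Set.Ici a).indicator 1 ((x : E3) 2) * g x ∂area)) := by
  obtain ⟨C, hC0, hC⟩ := exists_bound_of_continuous hg
  have hev : ∀ᶠ ε in 𝓝[>] (0 : ℝ), 0 < ε ∧ -1 ≤ a - ε := by
    filter_upwards [self_mem_nhdsWithin,
      nhdsWithin_le_nhds (gt_mem_nhds (show (0 : ℝ) < a + 1 by linarith))] with ε h1 h2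
    exact ⟨h1, by linarith⟩
  have h : Tendsto (fun ε => ∫ x : S2, (0 + ∫ s in (-1 : ℝ)..(x : E3) 2, spike a ε s) * g x ∂area)
      (𝓝[>] 0) (𝓝 (∫ x : S2, (Set.Ici a).indicator 1 ((x : E3) 2) * g x ∂area)) := by
    refine tendsto_integral_filter_of_dominated_convergence (fun _ => C) ?_ ?_
      (integrable_const C) ?_
    · exact Eventually.of_forall fun ε => ((continuous_const.add (continuous_primitive_height
        (integrable_spike a ε).intervalIntegrable)).mul hg).aestronglyMeasurable
    · filter_upwards [hev] with ε hε
      refine ae_of_all _ fun x => ?_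
      rw [norm_mul, zero_add, primitive_spike hε.2 x.height_mem.1]
      refine (mul_le_mul ?_ (hC x) (abs_nonneg _) zero_le_one).trans (one_mul C).le
      rw [Real.norm_of_nonneg (mul_nonneg (le_max_right _ _) (inv_pos.2 hε.1).le),
        ← div_eq_mul_inv, div_le_one hε.1]
      refine max_le ?_ hε.1.le
      linarith [min_le_right ((x : E3) 2) a]
    · refine ae_of_all _ fun x => ?_
      refine Tendsto.mul_const _ ?_
      refine tendsto_const_nhds.congr' ?_
      by_cases hx : a ≤ (x : E3) 2
      · filter_upwards [hev] with ε hε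
        rw [zero_add, primitive_spike hε.2 x.height_mem.1, min_eq_right hx]
        simp [hx, hε.1.le, hε.1.ne']
      · rw [not_le] at hx
        filter_upwards [hev, nhdsWithin_le_nhds (gt_mem_nhds (sub_pos.2 hx))] with ε hε h2
        rw [zero_add, primitive_spike hε.2 x.height_mem.1, min_eq_left hx.le,
          max_eq_right (by linarith)]
        simp [hx]
  refine h.congr fun ε => ?_
  exact (integral_height_ibp hf hg H (integrable_spike a ε).intervalIntegrable 0).symm

/-- By uniformity of the height this is `2π` times the average of `χ` over `(a - ε, a]`, a
difference quotient of its primitive. -/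
lemma tendsto_integral_spike_height {a : ℝ} (ha : -1 < a) (ha1 : a < 1) {χ : ℝ → ℝ}
    (hχ : Continuous χ) :
    Tendsto (fun ε => ∫ x : S2, spike a ε ((x : E3) 2) * χ ((x : E3) 2) ∂area) (𝓝[>] 0)
      (𝓝 (2 * Real.pi * χ a)) := by
  have hd : HasDerivAt (fun h => ∫ s in a..h, χ s) (χ a) a :=
    intervalIntegral.integral_hasDerivAt_right (hχ.intervalIntegrable _ _)
      hχ.stronglyMeasurable.stronglyMeasurableAtFilter hχ.continuousAt
  have ht : Tendsto (fun ε : ℝ => a - ε) (𝓝[>] 0) (𝓝[≠] a) := by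
    refine tendsto_nhdsWithin_iff.2 ⟨?_, ?_⟩
    · have : Tendsto (fun ε : ℝ => a - ε) (𝓝 0) (𝓝 (a - 0)) := by
        exact (continuous_const.sub continuous_id).tendsto 0
      rw [sub_zero] at this
      exact this.mono_left nhdsWithin_le_nhds
    · filter_upwards [self_mem_nhdsWithin] with ε hε
      have : (0 : ℝ) < ε := hε
      simp [this.ne']
  refine ((hd.tendsto_slope.comp ht).const_mul (2 * Real.pi)).congr' ?_
  filter_upwards [self_mem_nhdsWithin,
      nhdsWithin_le_nhds (gt_mem_nhds (show (0 : ℝ) < a + 1 by linarith))] with ε h1 h2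
  have h1 : 0 < ε := h1
  have hm : AEStronglyMeasurable (fun s => spike a ε s * χ s)
      (volume.restrict (Set.Ioc (-1 : ℝ) 1)) :=
    ((integrable_spike a ε).aestronglyMeasurable.mul hχ.aestronglyMeasurable).restrict
  rw [integral_height (f := fun s => spike a ε s * χ s) hm]
  have : (fun s => spike a ε s * χ s) = (Set.Ioc (a - ε) a).indicator fun s => ε⁻¹ * χ s := by
    ext s
    by_cases hs : s ∈ Set.Ioc (a - ε) a <;> simp [spike, hs]
  rw [intervalIntegral.integral_of_le (by norm_num), this,
    setIntegral_indicator measurableSet_Ioc, Set.Ioc_inter_Ioc, max_eq_right (by linarith),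
    min_eq_right ha1.le, integral_const_mul, ← intervalIntegral.integral_of_le (by linarith)]
  simp only [Function.comp, slope, intervalIntegral.integral_same, vsub_eq_sub, sub_zero,
    smul_eq_mul]
  rw [intervalIntegral.integral_symm (a - ε) a, show a - ε - a = -ε by ring, inv_neg]
  ring

end HeightIntegration

/-! ### The flux of tangent fields out of caps. -/

section Flux

lemma contDiff_coord {X : E3 → E3} (hX : ContDiff ℝ ∞ X) (i : Fin 3) :
    ContDiff ℝ 1 fun y => X y i := by
  have : ContDiff ℝ 1 X := hX.of_le (by exact_mod_cast le_top)
  fun_prop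

lemma fderiv_coord {X : E3 → E3} (hX : ContDiff ℝ ∞ X) (i : Fin 3) (y v : E3) :
    fderiv ℝ (fun y => X y i) y v = fderiv ℝ X y v i := by
  have h : HasFDerivAt X (fderiv ℝ X y) y := (hX.differentiable (by simp) y).hasFDerivAt
  have h2 := ((EuclideanSpace.proj i : E3 →L[ℝ] ℝ).hasFDerivAt).comp y h
  rw [show (fun y => X y i) = (EuclideanSpace.proj i : E3 →L[ℝ] ℝ) ∘ X from rfl, h2.fderiv]
  rfl

/-- Coordinate form of the divergence, which reduces integration by parts for a tangent field to the
divergence theorem for the constant fields. -/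
lemma sphereDiv_eq_sum {X : E3 → E3} (hX : ContDiff ℝ ∞ X) (x : S2) :
    sphereDiv X x
      = ∑ i : Fin 3, ⟪sphereGrad (fun x => X x i) x, EuclideanSpace.single i (1 : ℝ)⟫ := by
  have h0 : ∀ i : Fin 3, ⟪(x : E3), EuclideanSpace.single i (1 : ℝ)⟫ = (x : E3) i := fun i => by
    rw [EuclideanSpace.inner_single_right]; simp
  simp only [inner_sphereGrad_restrict (contDiff_coord hX _), fderiv_coord hX, map_sub, map_smul,
    PiLp.sub_apply, PiLp.smul_apply, h0, Finset.sum_sub_distrib]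
  rw [sphereDiv, LinearMap.trace_eq_sum_inner _ (EuclideanSpace.basisFun (Fin 3) ℝ)]
  congr 1
  · refine Finset.sum_congr rfl fun i _ => ?_
    simp [EuclideanSpace.inner_single_left]

lemma continuous_sphereDiv {X : E3 → E3} (hX : ContDiff ℝ ∞ X) : Continuous (sphereDiv X) := by
  rw [funext (sphereDiv_eq_sum hX)]
  exact continuous_finsetSum _ fun i _ =>
    ((isC1_restrict (contDiff_coord hX i)).continuous_sphereGrad).inner continuous_const

/-- Integration by parts for tangent fields against functions of the height. -/
lemma integral_deriv_height_mul {X : E3 → E3} (hX : ContDiff ℝ ∞ X)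
    (ht : ∀ x : S2, ⟪X x, (x : E3)⟫ = 0) {q : ℝ → ℝ} (hq : ContDiff ℝ 1 q) :
    ∫ x : S2, deriv q ((x : E3) 2) * X x 2 ∂area
      = ∫ x : S2, q ((x : E3) 2) * -sphereDiv X x ∂area := by
  have hc := fun i => isC1_restrict (contDiff_coord hX i)
  have hq1 := isC1_height_comp hq
  have hXc : Continuous fun x : S2 => X x := hX.continuous.comp continuous_subtype_val
  have hqc : Continuous fun x : S2 => q ((x : E3) 2) := hq.continuous.comp continuous_height
  have hqd : Continuous fun x : S2 => deriv q ((x : E3) 2) :=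
    (hq.continuous_deriv le_rfl).comp continuous_height
  have h0 : ∀ x : S2, ∀ i : Fin 3, ⟪(x : E3), EuclideanSpace.single i (1 : ℝ)⟫ = (x : E3) i :=
    fun x i => by rw [EuclideanSpace.inner_single_right]; simp
  -- The right sides of the divergence theorem for `q * X i` and the basis vectors add up to the
  -- integral of `2 q ⟪X, x⟫`, which is zero by tangency.
  have h1 : ∑ i : Fin 3, ∫ x : S2, ⟪sphereGrad (fun x => q ((x : E3) 2) * X x i) x,
      EuclideanSpace.single i (1 : ℝ)⟫ ∂area = 0 := by
    simp only [integral_inner_sphereGrad (hq1.mul (hc _)), h0]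
    rw [← Finset.mul_sum, ← integral_finsetSum _ fun i _ => integrable_of_continuous (by fun_prop)]
    rw [integral_eq_zero_of_ae, mul_zero]
    refine ae_of_all _ fun x => ?_
    have := ht x
    rw [PiLp.inner_apply] at this
    simp only [mul_assoc, ← Finset.mul_sum]
    rw [show ∑ i, X x i * (x : E3) i = 0 by rw [← this]; simp [mul_comm]]
    simp
  have h2 : ∀ x : S2, ∑ i : Fin 3, ⟪sphereGrad (fun x => q ((x : E3) 2) * X x i) x,
      EuclideanSpace.single i (1 : ℝ)⟫
      = deriv q ((x : E3) 2) * X x 2 + q ((x : E3) 2) * sphereDiv X x := by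
    intro x
    rw [sphereDiv_eq_sum hX, Finset.mul_sum]
    simp only [sphereGrad_mul hq1 (hc _), sphereGrad_height_comp hq, inner_add_left,
      inner_smul_left, inner_sub_left, Finset.sum_add_distrib, h0]
    have := ht x
    rw [PiLp.inner_apply] at this
    simp [Fin.sum_univ_three] at this ⊢
    have e : ∀ i, ⟪e3, EuclideanSpace.single i (1 : ℝ)⟫ = if i = 2 then 1 else 0 := by
      intro i; rw [e3_inner]; simp [eq_comm]
    simp only [e]
    simp
    linear_combination (-(deriv q ((x : E3) 2)) * (x : E3) 2) * this
  rw [← integral_finsetSum _ fun i _ => integrable_of_continuous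
    (((hq1.mul (hc i)).continuous_sphereGrad).inner continuous_const)] at h1
  simp only [h2] at h1
  have i1 : Integrable (fun x : S2 => deriv q ((x : E3) 2) * X x 2) area :=
    integrable_of_continuous (hqd.mul (by fun_prop))
  have i2 : Integrable (fun x : S2 => q ((x : E3) 2) * sphereDiv X x) area :=
    integrable_of_continuous (hqc.mul (continuous_sphereDiv hX))
  rw [integral_add i1 i2] at h1
  simp only [mul_neg, integral_neg]
  linarith

/-- The indicator function of the cap of heights at least `a`. -/
noncomputable def capInd (a : ℝ) (x : S2) : ℝ := (Set.Ici a).indicator 1 ((x : E3) 2)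

lemma measurable_capInd (a : ℝ) : Measurable (capInd a) :=
  (measurable_one.indicator measurableSet_Ici).comp continuous_height.measurable

lemma abs_capInd_le (a : ℝ) (x : S2) : |capInd a x| ≤ 1 := by
  by_cases h : a ≤ (x : E3) 2 <;> simp [capInd, h]

lemma integrable_capInd_mul (a : ℝ) {g : S2 → ℝ} (hg : Continuous g) :
    Integrable (fun x => capInd a x * g x) area :=
  (integrable_of_continuous hg).bdd_mul (c := 1) (measurable_capInd a).aestronglyMeasurable
    (ae_of_all _ fun x => abs_capInd_le a x)

lemma integrable_capInd (a : ℝ) : Integrable (capInd a) area := by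
  simpa using integrable_capInd_mul a (g := fun _ => 1) continuous_const

lemma integral_sphereDiv {X : E3 → E3} (hX : ContDiff ℝ ∞ X)
    (ht : ∀ x : S2, ⟪X x, (x : E3)⟫ = 0) : ∫ x, sphereDiv X x ∂area = 0 := by
  have := integral_deriv_height_mul hX ht (q := fun _ => 1) contDiff_const
  simpa [integral_neg] using this

lemma continuous_sqrt_one_sub_sq : Continuous fun s : ℝ => Real.sqrt (1 - s ^ 2) := by fun_prop

lemma norm_tangent_height (x : S2) :
    ‖e3 - (x : E3) 2 • (x : E3)‖ = Real.sqrt (1 - (x : E3) 2 ^ 2) := by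
  rw [eq_comm, Real.sqrt_eq_iff_eq_sq (by nlinarith [x.height_mem.1, x.height_mem.2])
    (norm_nonneg _), norm_sub_sq_real, inner_smul_right, e3_inner, norm_smul, S2.norm_coe]
  simp [e3]
  ring

/-- For a tangent vector the vertical component is the inner product with the tangential part of
`e3`, whose norm is `√(1 - h²)`; apply Cauchy–Schwarz. -/
lemma abs_height_le_of_tangent {X : E3} {x : S2} (ht : ⟪X, (x : E3)⟫ = 0) (hn : ‖X‖ ≤ 1) :
    |X 2| ≤ Real.sqrt (1 - (x : E3) 2 ^ 2) := by
  have h1 : ⟪X, e3 - (x : E3) 2 • (x : E3)⟫ = X 2 := by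
    rw [inner_sub_right, inner_smul_right, ht, inner_e3]; ring
  rw [← h1, ← norm_tangent_height]
  exact (abs_real_inner_le_norm _ _).trans (mul_le_of_le_one_left (norm_nonneg _) hn)

/-- The flux of a unit tangent field out of a cap is at most the perimeter of the cap. -/
lemma abs_integral_capInd_mul_sphereDiv_le {X : E3 → E3} (hX : IsUnitTangentField X) {a : ℝ}
    (ha : -1 < a) (ha1 : a < 1) :
    |∫ x, capInd a x * sphereDiv X x ∂area| ≤ 2 * Real.pi * Real.sqrt (1 - a ^ 2) := by
  have hXc : Continuous fun x : S2 => X x 2 :=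
    (contDiff_coord hX.smooth 2).continuous.comp continuous_subtype_val
  -- The flux is a limit of spike averages of the vertical component of `X`, and the averages of its
  -- bound `√(1 - h²)` tend to the perimeter.
  have h1 := (tendsto_integral_spike hXc (continuous_sphereDiv hX.smooth).fun_neg
    (fun q hq => integral_deriv_height_mul hX.smooth hX.tangent hq) ha).abs
  have h2 := tendsto_integral_spike_height ha ha1 continuous_sqrt_one_sub_sq
  have key : ∀ ε : ℝ, 0 < ε → |∫ x : S2, spike a ε ((x : E3) 2) * X x 2 ∂area|
      ≤ ∫ x : S2, spike a ε ((x : E3) 2) * Real.sqrt (1 - (x : E3) 2 ^ 2) ∂area := by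
    intro ε hε
    have hi : Integrable (fun x : S2 => spike a ε ((x : E3) 2) * Real.sqrt (1 - (x : E3) 2 ^ 2))
        area := intervalIntegrable_bounded_mul
          (f := fun x : S2 => Real.sqrt (1 - (x : E3) 2 ^ 2)) (r := spike a ε)
          (by fun_prop) (integrable_spike a ε).intervalIntegrable
    refine abs_integral_le_integral_abs.trans (integral_mono_of_nonneg
      (ae_of_all _ fun x => abs_nonneg _) hi (ae_of_all _ fun x => ?_))
    show |spike a ε ((x : E3) 2) * X x 2|
      ≤ spike a ε ((x : E3) 2) * Real.sqrt (1 - (x : E3) 2 ^ 2)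
    rw [abs_mul, abs_of_nonneg (spike_nonneg hε _)]
    exact mul_le_mul_of_nonneg_left (abs_height_le_of_tangent (hX.tangent x) (hX.norm_le_one x))
      (spike_nonneg hε _)
  have h3 := le_of_tendsto_of_tendsto h1 h2
    (by filter_upwards [self_mem_nhdsWithin] with ε hε using key ε hε)
  simp only [mul_neg, integral_neg, abs_neg] at h3
  exact h3

lemma integral_capInd_mul_sphereDiv {X : E3 → E3} (hX : ContDiff ℝ ∞ X)
    (ht : ∀ x : S2, ⟪X x, (x : E3)⟫ = 0) {χ : ℝ → ℝ} (hχ : Continuous χ)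
    (h : ∀ x : S2, X x 2 = χ ((x : E3) 2)) {a : ℝ} (ha : -1 < a) (ha1 : a < 1) :
    ∫ x, capInd a x * sphereDiv X x ∂area = -(2 * Real.pi * χ a) := by
  have hXc : Continuous fun x : S2 => X x 2 := by
    simp only [h]; exact hχ.comp continuous_height
  have h1 := tendsto_integral_spike hXc (continuous_sphereDiv hX).fun_neg
    (fun q hq => integral_deriv_height_mul hX ht hq) ha
  simp only [h] at h1
  have h2 := tendsto_nhds_unique h1 (tendsto_integral_spike_height ha ha1 hχ)
  simp only [mul_neg, integral_neg] at h2
  rw [← h2, neg_neg]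
  rfl

end Flux

/-! ### Patterns as alternating sums of caps. -/

section Pattern

/-- An initial segment of `Fin n` is determined by its cardinality. -/
lemma antitone_iff_lt_card {n : ℕ} (P : Fin n → Prop) [DecidablePred P]
    (hP : ∀ k l, k ≤ l → P l → P k) (k : Fin n) :
    P k ↔ (k : ℕ) < (Finset.univ.filter P).card := by
  constructor
  · intro h
    have hsub : Finset.Iic k ⊆ Finset.univ.filter P := fun l hl => by
      simpa using hP l k (Finset.mem_Iic.1 hl) h
    have := Finset.card_le_card hsub
    rw [Fin.card_Iic] at this
    omega
  · intro h
    by_contra hk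
    have hsub : Finset.univ.filter P ⊆ Finset.Iio k := fun l hl => by
      rw [Finset.mem_Iio]
      by_contra hlk
      exact hk (hP k l (not_lt.1 hlk) (by simpa using hl))
    have := Finset.card_le_card hsub
    rw [Fin.card_Iio] at this
    omega

lemma sum_alternating (N : ℕ) : ∑ k ∈ Finset.range N, 2 * (-1 : ℝ) ^ k = 1 - (-1) ^ N := by
  induction N with
  | zero => simp
  | succ N ih => rw [Finset.sum_range_succ, ih]; ring

/-- An axisymmetric pattern is an alternating sum of indicator functions of caps. -/
lemma pattern_eq_sum {n : ℕ} {z : Fin n → ℝ} (hz : StrictMono z) (x : S2) :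
    pattern z x = -1 + ∑ k : Fin n, 2 * (-1 : ℝ) ^ (k : ℕ) * capInd (z k) x := by
  set N := (Finset.univ.filter fun k => z k ≤ (x : E3) 2).card with hN
  have hNn : N ≤ n := (Finset.card_le_univ _).trans (by simp)
  have h : ∀ k : Fin n, 2 * (-1 : ℝ) ^ (k : ℕ) * capInd (z k) x
      = if (k : ℕ) < N then 2 * (-1 : ℝ) ^ (k : ℕ) else 0 := by
    intro k
    have := antitone_iff_lt_card (fun k => z k ≤ (x : E3) 2)
      (fun k l hkl hl => (hz.monotone hkl).trans hl) k
    by_cases hk : z k ≤ (x : E3) 2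
    · rw [if_pos (this.1 hk)]; simp [capInd, hk]
    · rw [if_neg fun hc => hk (this.2 hc)]; simp [capInd, hk]
  simp only [h]
  rw [Fin.sum_univ_eq_sum_range (fun k => if k < N then 2 * (-1 : ℝ) ^ k else 0) n,
    ← Finset.sum_filter, show (Finset.range n).filter (· < N) = Finset.range N by
      ext k; simp; omega, sum_alternating, pattern, ← hN]
  ring

lemma integral_capInd {a : ℝ} (ha : -1 < a) (ha1 : a < 1) :
    ∫ x, capInd a x ∂area = 2 * Real.pi * (1 - a) := by
  have h := integral_height (f := (Set.Ici a).indicator 1)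
    (measurable_one.indicator measurableSet_Ici).aestronglyMeasurable
  have h2 : ∫ s in (-1 : ℝ)..1, (Set.Ici a).indicator (1 : ℝ → ℝ) s = 1 - a := by
    rw [intervalIntegral.integral_of_le (by norm_num), integral_indicator_one measurableSet_Ici,
      measureReal_restrict_apply measurableSet_Ici, show Set.Ici a ∩ Set.Ioc (-1) 1 = Set.Icc a 1 by
        ext s; simp only [Set.mem_inter_iff, Set.mem_Ici, Set.mem_Ioc, Set.mem_Icc]
        exact ⟨fun h => ⟨h.1, h.2.2⟩, fun h => ⟨h.1, by linarith [h.1], h.2⟩⟩, Real.volume_real_Icc_of_le ha1.le]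
  rw [← h2, ← h]
  rfl

/-- The mean is affine in the interfaces, so the constraint on their speeds is linear. -/
lemma mass_pattern {n : ℕ} {z : Fin n → ℝ} (hz : IsInterfaces z) :
    mass (pattern z) = -1 + ∑ k : Fin n, (-1 : ℝ) ^ (k : ℕ) * (1 - z k) := by
  have hpi := Real.pi_pos
  rw [mass, funext (pattern_eq_sum hz.strictMono), integral_add (integrable_const _)
    (integrable_finsetSum _ fun k _ => (integrable_capInd _).const_mul _), integral_area_const,
    integral_finsetSum _ fun k _ => (integrable_capInd _).const_mul _]
  simp only [integral_const_mul, integral_capInd (hz.gt_neg_one _) (hz.lt_one _)]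
  rw [mul_add, Finset.mul_sum]
  congr 1
  · field_simp
  · refine Finset.sum_congr rfl fun k _ => ?_
    field_simp
    ring

lemma integrable_pattern_mul {n : ℕ} {z : Fin n → ℝ} (hz : StrictMono z) {g : S2 → ℝ}
    (hg : Continuous g) : Integrable (fun x => pattern z x * g x) area := by
  simp only [pattern_eq_sum hz, add_mul, Finset.sum_mul, mul_assoc]
  exact (integrable_of_continuous (continuous_const.mul hg)).add
    (integrable_finsetSum _ fun k _ => ((integrable_capInd_mul _ hg).const_mul _).const_mul _)

lemma integral_pattern_mul {n : ℕ} {z : Fin n → ℝ} (hz : StrictMono z) {g : S2 → ℝ}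
    (hg : Continuous g) : ∫ x, pattern z x * g x ∂area = -(∫ x, g x ∂area)
      + ∑ k : Fin n, 2 * (-1 : ℝ) ^ (k : ℕ) * ∫ x, capInd (z k) x * g x ∂area := by
  simp only [pattern_eq_sum hz, add_mul, Finset.sum_mul, mul_assoc]
  have h1 : Integrable (fun x => -1 * g x) area :=
    integrable_of_continuous (continuous_const.mul hg)
  rw [integral_add h1
    (integrable_finsetSum _ fun k _ => ((integrable_capInd_mul _ hg).const_mul _).const_mul _),
    integral_finsetSum _ fun k _ => ((integrable_capInd_mul _ hg).const_mul _).const_mul _]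
  simp only [integral_const_mul]
  ring

end Pattern

/-! ### The total variation of a pattern. -/

section Perimeter

lemma exists_bound_interfaces {n : ℕ} {z : Fin n → ℝ} (hz : IsInterfaces z) :
    ∃ r : ℝ, 0 < r ∧ r < 1 ∧ ∀ k, |z k| ≤ r := by
  have h : ∀ᶠ r in 𝓝[<] (1 : ℝ), 0 < r ∧ r < 1 ∧ ∀ k, |z k| ≤ r := by
    have h1 : ∀ᶠ r in 𝓝[<] (1 : ℝ), ∀ k, |z k| ≤ r := by
      rw [eventually_all]
      intro k
      have : |z k| < 1 := abs_lt.2 ⟨hz.gt_neg_one k, hz.lt_one k⟩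
      filter_upwards [nhdsWithin_le_nhds (lt_mem_nhds this)] with r hr using hr.le
    filter_upwards [h1, nhdsWithin_le_nhds (lt_mem_nhds (zero_lt_one (α := ℝ))),
      self_mem_nhdsWithin] with r h1 h2 h3 using ⟨h2, h3, h1⟩
  exact h.exists

/-- A smooth profile whose product with `√(1 - s²)` is bounded by one and takes prescribed values
`±1` at the interfaces. -/
lemma exists_profile {n : ℕ} {z : Fin n → ℝ} (hz : IsInterfaces z) {σ : Fin n → ℝ}
    (hσ : ∀ k, σ k = 1 ∨ σ k = -1) :
    ∃ ψ : ℝ → ℝ, ContDiff ℝ ∞ ψ ∧ (∀ s, |ψ s| * Real.sqrt (1 - s ^ 2) ≤ 1) ∧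
      ∀ k, ψ (z k) * (1 - z k ^ 2) = σ k * Real.sqrt (1 - z k ^ 2) := by
  obtain ⟨r, hr0, hr1, hr⟩ := exists_bound_interfaces hz
  -- The bump is 1 at all interfaces, and its outer radius `(1 + r) / 2 < 1` keeps the support away
  -- from the zeros of `√(1 - s²)`.
  let b : ContDiffBump (0 : ℝ) := ⟨r, (1 + r) / 2, hr0, by linarith⟩
  let P : Polynomial ℝ := Lagrange.interpolate Finset.univ z σ
  have hP : ∀ k, P.eval (z k) = σ k := fun k =>
    Lagrange.eval_interpolate_at_node σ hz.strictMono.injective.injOn (Finset.mem_univ k)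
  -- Composing the interpolating polynomial with `sin (π/2 ·)` keeps the values `±1` at the nodes
  -- and bounds the profile by one elsewhere.
  refine ⟨fun s => b s * (Real.sin (Real.pi / 2 * P.eval s) / Real.sqrt (1 - s ^ 2)), ?_, ?_, ?_⟩
  · refine contDiff_iff_contDiffAt.2 fun s => ?_
    by_cases hs : s ∈ tsupport fun s =>
        b s * (Real.sin (Real.pi / 2 * P.eval s) / Real.sqrt (1 - s ^ 2))
    swap
    · exact contDiffAt_const.congr_of_eventuallyEq (notMem_tsupport_iff_eventuallyEq.1 hs)
    have hs' : s ∈ tsupport b := tsupport_mul_subset_left hs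
    rw [b.tsupport_eq, Real.closedBall_eq_Icc] at hs'
    have h1 : -((1 + r) / 2) ≤ s := by simpa using hs'.1
    have h2 : s ≤ (1 + r) / 2 := by simpa using hs'.2
    have hpos : 0 < 1 - s ^ 2 := by nlinarith
    have hP1 : ContDiff ℝ ∞ fun s => P.eval s := by
      simpa using P.contDiff_aeval (𝕜 := ℝ) (n := ∞)
    refine b.contDiff.contDiffAt.mul (ContDiffAt.div ?_ ?_ (Real.sqrt_pos.2 hpos).ne')
    · exact (Real.contDiff_sin.comp (contDiff_const.mul hP1)).contDiffAt
    · exact ContDiffAt.sqrt (by fun_prop) hpos.ne'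
  · intro s
    have hsq := Real.sqrt_nonneg (1 - s ^ 2)
    rw [abs_mul, abs_div, abs_of_nonneg b.nonneg, abs_of_nonneg hsq, mul_assoc]
    refine mul_le_one₀ b.le_one (by positivity) ?_
    rcases hsq.eq_or_lt with h | h
    · rw [← h]; simp
    · rw [div_mul_cancel₀ _ h.ne']; exact Real.abs_sin_le_one _
  · intro k
    have hb : b (z k) = 1 := b.one_of_mem_closedBall (by simpa [b] using hr k)
    have hpos : 0 < 1 - z k ^ 2 := by
      nlinarith [hz.gt_neg_one k, hz.lt_one k]
    have hs : Real.sin (Real.pi / 2 * σ k) = σ k := by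
      rcases hσ k with h | h <;> simp [h]
    simp only [hb, hP, hs]
    have h1 := Real.sq_sqrt hpos.le
    have h2 := Real.sqrt_pos.2 hpos
    field_simp
    rw [h1]

/-- The total variation of an axisymmetric pattern is twice the total length of the interfaces. -/
theorem totalVariation_pattern {n : ℕ} {z : Fin n → ℝ} (hz : IsInterfaces z) :
    totalVariation (pattern z)
      = ENNReal.ofReal (4 * Real.pi * ∑ k, Real.sqrt (1 - z k ^ 2)) := by
  have hpi := Real.pi_pos
  have hint : ∀ X : E3 → E3, IsUnitTangentField X → ∫ x, pattern z x * sphereDiv X x ∂area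
      = ∑ k : Fin n, 2 * (-1 : ℝ) ^ (k : ℕ) * ∫ x, capInd (z k) x * sphereDiv X x ∂area := by
    intro X hX
    rw [integral_pattern_mul hz.strictMono (continuous_sphereDiv hX.smooth),
      integral_sphereDiv hX.smooth hX.tangent, neg_zero, zero_add]
  refine le_antisymm (iSup₂_le fun X hX => ENNReal.ofReal_le_ofReal ?_) ?_
  · rw [hint X hX, Finset.mul_sum]
    refine Finset.sum_le_sum fun k _ => ?_
    have h := abs_integral_capInd_mul_sphereDiv_le hX (hz.gt_neg_one k) (hz.lt_one k)
    refine (le_abs_self _).trans ?_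
    rw [abs_mul, abs_mul, abs_pow]
    simp only [abs_neg, abs_one, one_pow, mul_one, abs_two]
    linarith
  -- The signs compensate the alternating jumps and the minus sign in
  -- `integral_capInd_mul_sphereDiv`, so that every interface contributes its full length.
  · obtain ⟨ψ, hψ, hψ1, hψz⟩ := exists_profile hz (σ := fun k => -(-1 : ℝ) ^ (k : ℕ)) fun k => by
      rcases neg_one_pow_eq_or ℝ (k : ℕ) with h | h <;> simp [h]
    have hX : IsUnitTangentField fun y : E3 => ψ (y 2) • (e3 - y 2 • y) := by
      refine ⟨?_, fun x => ?_, fun x => ?_⟩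
      · exact (hψ.comp contDiff_height).smul (contDiff_const.sub (contDiff_height.smul contDiff_id))
      · rw [inner_smul_left, inner_sub_left, inner_smul_left, S2.inner_self, e3_inner]
        simp
      · rw [norm_smul, norm_tangent_height]
        exact hψ1 _
    refine le_trans (le_of_eq ?_)
      (le_iSup₂ (f := fun X (_ : IsUnitTangentField X) =>
        ENNReal.ofReal (∫ x, pattern z x * sphereDiv X x ∂area)) _ hX)
    congr 1
    rw [hint _ hX, Finset.mul_sum]
    refine Finset.sum_congr rfl fun k _ => ?_
    rw [integral_capInd_mul_sphereDiv hX.smooth hX.tangent (χ := fun s => ψ s * (1 - s ^ 2))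
      (hψ.continuous.mul (by fun_prop)) (fun x => ?_) (hz.gt_neg_one k) (hz.lt_one k)]
    · rw [hψz]
      have : (-1 : ℝ) ^ (k : ℕ) * (-1) ^ (k : ℕ) = 1 := by
        rw [← mul_pow]; simp
      linear_combination (-4 * Real.pi * Real.sqrt (1 - z k ^ 2)) * this
    · simp [e3]
      left; ring

end Perimeter

/-! ### The explicit potential of a cap. -/

section CapPotential

/-- Derivative in the height of the potential of a cap. -/
noncomputable def capSlope (a h : ℝ) : ℝ :=
  (1 - a) * (1 + a) / (2 * ((1 - min a h) * (1 + max a h)))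

/-- The potential generated by the cap of heights at least `a`, as a function of the height. -/
noncomputable def capPotential (a h : ℝ) : ℝ :=
  -((1 - a) / 2) * Real.log (1 - min a h) + (1 + a) / 2 * Real.log (1 + max a h)

/-- Second derivative in the height of the potential of a cap. -/
noncomputable def capBend (a h : ℝ) : ℝ :=
  (Set.Iio a).indicator (fun h => (1 - a) / (2 * (1 - min a h) ^ 2)) h
    + (Set.Ici a).indicator (fun h => -((1 + a) / (2 * (1 + max a h) ^ 2))) h

variable {a : ℝ}

/-- The truncations by `min` and `max` keep denominators and arguments of logarithms positive for
every real `h`, not only on `[-1, 1]`. -/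
lemma one_sub_min_pos (ha1 : a < 1) (h : ℝ) : 0 < 1 - min a h := by
  linarith [min_le_left a h]

lemma one_add_max_pos (ha : -1 < a) (h : ℝ) : 0 < 1 + max a h := by
  linarith [le_max_left a h]

/-- The formulas on the two sides of `a` come from $-((1-h^2)V')'=1_{h\ge a}-(1-a)/2$ integrated
from the pole: $(1-h^2)V'$ is $(1-a)(1+h)/2$ below `a` and $(1+a)(1-h)/2$ above. -/
lemma capSlope_of_le (ha : -1 < a) {h : ℝ} (hh : h ≤ a) :
    capSlope a h = (1 - a) / (2 * (1 - h)) := by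
  rw [capSlope, min_eq_right hh, max_eq_left hh,
    show 2 * ((1 - h) * (1 + a)) = (2 * (1 - h)) * (1 + a) by ring,
    mul_div_mul_right _ _ (by linarith)]

lemma capSlope_of_ge (ha1 : a < 1) {h : ℝ} (hh : a ≤ h) :
    capSlope a h = (1 + a) / (2 * (1 + h)) := by
  rw [capSlope, min_eq_left hh, max_eq_right hh,
    show 2 * ((1 - a) * (1 + h)) = (1 - a) * (2 * (1 + h)) by ring,
    mul_div_mul_left _ _ (by linarith)]

lemma continuous_capSlope (ha : -1 < a) (ha1 : a < 1) : Continuous (capSlope a) := by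
  unfold capSlope
  refine Continuous.div (by fun_prop) (by fun_prop) fun h => ?_
  have := one_sub_min_pos ha1 h
  have := one_add_max_pos ha h
  positivity

lemma hasDerivAt_of_Iic_of_Ici {f : ℝ → ℝ} {f' h : ℝ} (h1 : h ≤ a → HasDerivWithinAt f f' (Set.Iic a) h)
    (h2 : a ≤ h → HasDerivWithinAt f f' (Set.Ici a) h) : HasDerivAt f f' h := by
  rcases lt_trichotomy h a with hh | hh | hh
  · exact (h1 hh.le).hasDerivAt (Iic_mem_nhds hh)
  · have := (h1 hh.le).union (h2 hh.ge)
    rwa [Set.Iic_union_Ici, hasDerivWithinAt_univ] at this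
  · exact (h2 hh.le).hasDerivAt (Ici_mem_nhds hh)

lemma hasDerivAt_capPotential (ha : -1 < a) (ha1 : a < 1) (h : ℝ) :
    HasDerivAt (capPotential a) (capSlope a h) h := by
  refine hasDerivAt_of_Iic_of_Ici (a := a) (fun hh => ?_) (fun hh => ?_)
  · rw [capSlope_of_le ha hh]
    have hne : 1 - h ≠ 0 := by linarith
    have hd : HasDerivAt (fun h => -((1 - a) / 2) * Real.log (1 - h)
        + (1 + a) / 2 * Real.log (1 + a)) ((1 - a) / (2 * (1 - h))) h := by
      have := ((((hasDerivAt_id h).const_sub 1).log hne).const_mul (-((1 - a) / 2))).add_const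
        ((1 + a) / 2 * Real.log (1 + a))
      convert! this using 1
      simp only [id]
      field_simp
    refine hd.hasDerivWithinAt.congr (fun s hs => ?_) ?_
    · rw [capPotential, min_eq_right hs, max_eq_left hs]
    · rw [capPotential, min_eq_right hh, max_eq_left hh]
  · rw [capSlope_of_ge ha1 hh]
    have hne : 1 + h ≠ 0 := by linarith
    have hd : HasDerivAt (fun h => -((1 - a) / 2) * Real.log (1 - a)
        + (1 + a) / 2 * Real.log (1 + h)) ((1 + a) / (2 * (1 + h))) h := by
      have := ((((hasDerivAt_id h).const_add 1).log hne).const_mul ((1 + a) / 2)).const_add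
        (-((1 - a) / 2) * Real.log (1 - a))
      convert! this using 1
      simp only [id]
      field_simp
    refine hd.hasDerivWithinAt.congr (fun s hs => ?_) ?_
    · rw [capPotential, min_eq_left hs, max_eq_right hs]
    · rw [capPotential, min_eq_left hh, max_eq_right hh]

lemma contDiff_capPotential (ha : -1 < a) (ha1 : a < 1) : ContDiff ℝ 1 (capPotential a) := by
  rw [contDiff_one_iff_deriv]
  refine ⟨fun h => (hasDerivAt_capPotential ha ha1 h).differentiableAt, ?_⟩
  rw [show deriv (capPotential a) = capSlope a from
    funext fun h => (hasDerivAt_capPotential ha ha1 h).deriv]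
  exact continuous_capSlope ha ha1

lemma hasDerivAt_capSlope (ha : -1 < a) (ha1 : a < 1) {h : ℝ} (hh : h ≠ a) :
    HasDerivAt (capSlope a) (capBend a h) h := by
  rcases hh.lt_or_gt with hh | hh
  · have hne : 2 * (1 - h) ≠ 0 := by linarith
    have hd : HasDerivAt (fun h => (1 - a) / (2 * (1 - h))) ((1 - a) / (2 * (1 - h) ^ 2)) h := by
      have := (hasDerivAt_const h (1 - a)).div (((hasDerivAt_id h).const_sub 1).const_mul 2) hne
      convert! this using 1
      simp only [id]
      have : 1 - h ≠ 0 := by linarith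
      field_simp
      ring
    have hb : capBend a h = (1 - a) / (2 * (1 - h) ^ 2) := by
      simp [capBend, hh, hh.le]
    rw [hb]
    refine hd.congr_of_eventuallyEq ?_
    filter_upwards [gt_mem_nhds hh] with s hs using capSlope_of_le ha hs.le
  · have hne : 2 * (1 + h) ≠ 0 := by linarith
    have hd : HasDerivAt (fun h => (1 + a) / (2 * (1 + h))) (-((1 + a) / (2 * (1 + h) ^ 2))) h := by
      have := (hasDerivAt_const h (1 + a)).div (((hasDerivAt_id h).const_add 1).const_mul 2) hne
      convert! this using 1
      simp only [id]
      have : 1 + h ≠ 0 := by linarith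
      field_simp
      ring
    have hb : capBend a h = -((1 + a) / (2 * (1 + h) ^ 2)) := by
      simp [capBend, hh.le]
    rw [hb]
    refine hd.congr_of_eventuallyEq ?_
    filter_upwards [lt_mem_nhds hh] with s hs using capSlope_of_ge ha1 hs.le

lemma intervalIntegrable_capBend (ha : -1 < a) (ha1 : a < 1) (b c : ℝ) :
    IntervalIntegrable (capBend a) volume b c := by
  have h1 : Continuous fun h => (1 - a) / (2 * (1 - min a h) ^ 2) := by
    refine Continuous.div (by fun_prop) (by fun_prop) fun h => ?_
    have := one_sub_min_pos ha1 h
    positivity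
  have h2 : Continuous fun h => -((1 + a) / (2 * (1 + max a h) ^ 2)) := by
    refine (Continuous.div (by fun_prop) (by fun_prop) fun h => ?_).neg
    have := one_add_max_pos ha h
    positivity
  refine IntervalIntegrable.add ?_ ?_
  · have := h1.intervalIntegrable (μ := volume) b c
    rw [intervalIntegrable_iff] at this ⊢
    exact IntegrableOn.indicator this measurableSet_Iio
  · have := h2.intervalIntegrable (μ := volume) b c
    rw [intervalIntegrable_iff] at this ⊢
    exact IntegrableOn.indicator this measurableSet_Ici

/-- The slope has a kink at `a`, so the fundamental theorem is used off one point. This is the form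
needed by `integral_height_ibp`. -/
lemma capSlope_eq_integral (ha : -1 < a) (ha1 : a < 1) (h : ℝ) :
    capSlope a h = capSlope a (-1) + ∫ s in (-1 : ℝ)..h, capBend a s := by
  have := integral_eq_of_hasDerivAt_off_countable (capSlope a) (capBend a)
    (a := -1) (b := h) (Set.countable_singleton a) (continuous_capSlope ha ha1).continuousOn
    (fun s hs => hasDerivAt_capSlope ha ha1 (by simpa using hs.2))
    (intervalIntegrable_capBend ha ha1 _ _)
  rw [this]; ring

/-- The pointwise Poisson equation: for a function of the height, $-\Delta V=2hV'-(1-h^2)V''$, and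
the cap has mean `(1 - a) / 2`. The choice of `capBend` at `a` makes it hold on the interface too.
-/
lemma two_mul_capSlope_sub (ha : -1 < a) (ha1 : a < 1) (x : S2) :
    2 * (x : E3) 2 * capSlope a ((x : E3) 2) - capBend a ((x : E3) 2) * (1 - (x : E3) 2 ^ 2)
      = capInd a x - (1 - a) / 2 := by
  set h := (x : E3) 2 with hdef
  by_cases hh : h < a
  · have hb : capBend a h = (1 - a) / (2 * (1 - h) ^ 2) := by
      simp [capBend, hh, hh.le]
    have hi : capInd a x = 0 := by simp [capInd, ← hdef, hh]
    rw [hb, hi, capSlope_of_le ha hh.le]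
    have : 1 - h ≠ 0 := by linarith
    field_simp
    ring
  · rw [not_lt] at hh
    have hb : capBend a h = -((1 + a) / (2 * (1 + h) ^ 2)) := by
      simp [capBend, hh]
    have hi : capInd a x = 1 := by simp [capInd, ← hdef, hh]
    rw [hb, hi, capSlope_of_ge ha1 hh]
    have : 1 + h ≠ 0 := by linarith
    field_simp
    ring

lemma e3_apply_two : e3 2 = 1 := by simp [e3]

lemma integral_deriv_height_mul_isC1 {φ : S2 → ℝ} (hφ : IsC1 φ) {q : ℝ → ℝ}
    (hq : ContDiff ℝ 1 q) :
    ∫ x : S2, deriv q ((x : E3) 2) * ((1 - (x : E3) 2 ^ 2) * φ x) ∂area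
      = ∫ x : S2, q ((x : E3) 2) * (2 * (x : E3) 2 * φ x - ⟪sphereGrad φ x, e3⟫) ∂area := by
  have hq1 := isC1_height_comp hq
  have hqc : Continuous fun x : S2 => q ((x : E3) 2) := hq.continuous.comp continuous_height
  have hqd : Continuous fun x : S2 => deriv q ((x : E3) 2) :=
    (hq.continuous_deriv le_rfl).comp continuous_height
  have hφc := hφ.continuous
  have hgc := hφ.continuous_sphereGrad
  have h := integral_inner_sphereGrad (hq1.mul hφ) e3
  have h2 : ∀ x : S2, ⟪sphereGrad (fun x => q ((x : E3) 2) * φ x) x, e3⟫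
      = q ((x : E3) 2) * ⟪sphereGrad φ x, e3⟫
        + deriv q ((x : E3) 2) * ((1 - (x : E3) 2 ^ 2) * φ x) := by
    intro x
    rw [sphereGrad_mul hq1 hφ, sphereGrad_height_comp hq, inner_add_left, inner_smul_left,
      inner_smul_left, inner_smul_left, inner_sub_left, inner_smul_left, inner_e3, inner_e3,
      inner_e3, e3_apply_two]
    simp
    ring
  simp only [h2, inner_e3] at h
  have i1 : Integrable (fun x : S2 => q ((x : E3) 2) * ⟪sphereGrad φ x, e3⟫) area :=
    integrable_of_continuous (hqc.mul (hgc.inner continuous_const))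
  have i2 : Integrable (fun x : S2 => deriv q ((x : E3) 2) * ((1 - (x : E3) 2 ^ 2) * φ x)) area :=
    integrable_of_continuous (hqd.mul ((by fun_prop : Continuous fun x : S2 =>
      1 - (x : E3) 2 ^ 2).mul hφc))
  have i3 : Integrable (fun x : S2 => q ((x : E3) 2) * φ x * (x : E3) 2) area :=
    integrable_of_continuous ((hqc.mul hφc).mul continuous_height)
  simp only [inner_e3] at i1
  rw [integral_add i1 i2] at h
  have h3 : ∀ x : S2, q ((x : E3) 2) * (2 * (x : E3) 2 * φ x - ⟪sphereGrad φ x, e3⟫)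
      = 2 * (q ((x : E3) 2) * φ x * (x : E3) 2) - q ((x : E3) 2) * sphereGrad φ x 2 := by
    intro x; rw [inner_e3]; ring
  simp only [h3]
  rw [integral_sub (i3.const_mul 2) i1, integral_const_mul]
  linarith

/-- The weak Poisson equation for a cap. -/
lemma integral_capSlope_mul (ha : -1 < a) (ha1 : a < 1) {φ : S2 → ℝ} (hφ : IsC1 φ) :
    ∫ x : S2, capSlope a ((x : E3) 2) * ⟪sphereGrad φ x, e3⟫ ∂area
      = ∫ x, (capInd a x - (1 - a) / 2) * φ x ∂area := by
  have hφc := hφ.continuous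
  have hgc := hφ.continuous_sphereGrad
  have hf : Continuous fun x : S2 => (1 - (x : E3) 2 ^ 2) * φ x :=
    (by fun_prop : Continuous fun x : S2 => 1 - (x : E3) 2 ^ 2).mul hφc
  have hgi : Continuous fun x : S2 => ⟪sphereGrad φ x, e3⟫ := hgc.inner continuous_const
  have h1 : Continuous fun x : S2 => 2 * (x : E3) 2 * φ x :=
    (by fun_prop : Continuous fun x : S2 => 2 * (x : E3) 2).mul hφc
  have hr := intervalIntegrable_capBend ha ha1 (-1) 1
  -- Here the slope plays the part of the test function of the height; it is absolutely continuous
  -- but not C¹.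
  have h := integral_height_ibp hf (h1.fun_sub hgi)
    (fun q hq => integral_deriv_height_mul_isC1 hφ hq) hr (capSlope a (-1))
  simp only [← capSlope_eq_integral ha ha1] at h
  have hs : Continuous fun x : S2 => capSlope a ((x : E3) 2) :=
    (continuous_capSlope ha ha1).comp continuous_height
  have i1 : Integrable (fun x : S2 => capSlope a ((x : E3) 2) * (2 * (x : E3) 2 * φ x)) area :=
    integrable_of_continuous (hs.mul h1)
  have i2 := intervalIntegrable_bounded_mul hf hr
  have i3 : Integrable (fun x : S2 => capSlope a ((x : E3) 2) * ⟪sphereGrad φ x, e3⟫) area :=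
    integrable_of_continuous (hs.mul hgi)
  have h4 := integral_sub i1 i3
  simp only [← mul_sub] at h4
  rw [h4] at h
  have h3 : ∀ x : S2, (capInd a x - (1 - a) / 2) * φ x
      = capSlope a ((x : E3) 2) * (2 * (x : E3) 2 * φ x)
        - capBend a ((x : E3) 2) * ((1 - (x : E3) 2 ^ 2) * φ x) := by
    intro x; rw [← two_mul_capSlope_sub ha ha1]; ring
  simp only [h3]
  rw [integral_sub i1 i2, h]
  ring

end CapPotential

/-! ### Existence, uniqueness and Dirichlet energy of the potential. -/

section Poisson

/-- The potential of an axisymmetric pattern as a function of the height. -/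
noncomputable def patternProfile {n : ℕ} (z : Fin n → ℝ) (h : ℝ) : ℝ :=
  ∑ k : Fin n, 2 * (-1 : ℝ) ^ (k : ℕ) * capPotential (z k) h

variable {n : ℕ} {z : Fin n → ℝ}

lemma hasDerivAt_patternProfile (hz : IsInterfaces z) (h : ℝ) :
    HasDerivAt (patternProfile z)
      (∑ k : Fin n, 2 * (-1 : ℝ) ^ (k : ℕ) * capSlope (z k) h) h :=
  HasDerivAt.fun_sum fun k _ =>
    (hasDerivAt_capPotential (hz.gt_neg_one k) (hz.lt_one k) h).const_mul _

lemma contDiff_patternProfile (hz : IsInterfaces z) : ContDiff ℝ 1 (patternProfile z) :=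
  ContDiff.sum fun k _ =>
    contDiff_const.mul (contDiff_capPotential (hz.gt_neg_one k) (hz.lt_one k))

/-- Superposition: the pattern minus its mean is the same alternating combination of the mean-free
caps. -/
theorem isPoissonSolution_pattern (hz : IsInterfaces z) {m : ℝ} (hm : mass (pattern z) = m) :
    IsPoissonSolution (pattern z) m fun x => patternProfile z ((x : E3) 2) := by
  refine ⟨isC1_height_comp (contDiff_patternProfile hz), fun φ hφ => ?_⟩
  have hφc := hφ.continuous
  have hgi : Continuous fun x : S2 => ⟪sphereGrad φ x, e3⟫ :=
    hφ.continuous_sphereGrad.inner continuous_const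
  have hl : ∀ x : S2, ⟪sphereGrad (fun x => patternProfile z ((x : E3) 2)) x, sphereGrad φ x⟫
      = ∑ k : Fin n, 2 * (-1 : ℝ) ^ (k : ℕ)
        * (capSlope (z k) ((x : E3) 2) * ⟪sphereGrad φ x, e3⟫) := by
    intro x
    rw [sphereGrad_height_comp (contDiff_patternProfile hz), (hasDerivAt_patternProfile hz _).deriv,
      inner_smul_left, inner_sub_left, inner_smul_left, real_inner_comm (sphereGrad φ x) (x : E3),
      hφ.inner_sphereGrad_self, real_inner_comm _ e3, mul_zero, sub_zero, conj_trivial,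
      Finset.sum_mul]
    exact Finset.sum_congr rfl fun k _ => by ring
  have hr : ∀ x : S2, (pattern z x - m) * φ x
      = ∑ k : Fin n, 2 * (-1 : ℝ) ^ (k : ℕ) * ((capInd (z k) x - (1 - z k) / 2) * φ x) := by
    intro x
    have : pattern z x - m
        = ∑ k : Fin n, 2 * (-1 : ℝ) ^ (k : ℕ) * (capInd (z k) x - (1 - z k) / 2) := by
      rw [← hm, mass_pattern hz, pattern_eq_sum hz.strictMono]
      rw [add_sub_add_left_eq_sub, ← Finset.sum_sub_distrib]
      exact Finset.sum_congr rfl fun k _ => by ring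
    rw [this, Finset.sum_mul]
    exact Finset.sum_congr rfl fun k _ => by ring
  simp only [hl, hr]
  rw [integral_finsetSum, integral_finsetSum]
  · refine Finset.sum_congr rfl fun k _ => ?_
    rw [integral_const_mul, integral_const_mul,
      integral_capSlope_mul (hz.gt_neg_one k) (hz.lt_one k) hφ]
  · intro k _
    simp only [sub_mul]
    exact ((integrable_capInd_mul _ hφc).sub
      (integrable_of_continuous (continuous_const.mul hφc))).const_mul _
  · intro k _
    have hs := (continuous_capSlope (hz.gt_neg_one k) (hz.lt_one k)).comp continuous_height
    exact (integrable_of_continuous (hs.mul hgi)).const_mul _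

/-- Testing both equations with `v - w` gives a vanishing Dirichlet integral; the gradient is
continuous and open sets have positive area, so it vanishes everywhere. -/
lemma IsPoissonSolution.ext_gradient {u : S2 → ℝ} {m : ℝ} {v w : S2 → ℝ}
    (hv : IsPoissonSolution u m v) (hw : IsPoissonSolution u m w) (x : S2) :
    sphereGrad (fun x => v x - w x) x = 0 := by
  have hd := hv.isC1.sub hw.isC1
  have hvc := hv.isC1.continuous_sphereGrad
  have hwc := hw.isC1.continuous_sphereGrad
  have hdc := hd.continuous_sphereGrad
  have h1 := hv.weak _ hd
  rw [← hw.weak _ hd, ← sub_eq_zero,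
    ← integral_sub (integrable_of_continuous (hvc.inner hdc))
      (integrable_of_continuous (hwc.inner hdc))] at h1
  simp only [← inner_sub_left, ← sphereGrad_sub hv.isC1 hw.isC1] at h1
  rw [integral_eq_zero_iff_of_nonneg (fun x => real_inner_self_nonneg)
    (integrable_of_continuous (hdc.inner hdc))] at h1
  have h2 := (Continuous.ae_eq_iff_eq area (hdc.inner hdc) continuous_const).1 h1
  exact inner_self_eq_zero.1 (congrFun h2 x)

/-- Solutions of the Poisson problem are unique up to an additive constant. -/
theorem IsPoissonSolution.exists_eq_add {u : S2 → ℝ} {m : ℝ} {v w : S2 → ℝ}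
    (hv : IsPoissonSolution u m v) (hw : IsPoissonSolution u m w) :
    ∃ c, ∀ x, v x = w x + c := by
  have hd := hv.isC1.sub hw.isC1
  have hconn : IsPreconnected ({0}ᶜ : Set E3) :=
    (isConnected_compl_singleton_of_one_lt_rank
      (by rw [← Module.finrank_eq_rank]; simp) _).isPreconnected
  obtain ⟨c, hc⟩ := isOpen_punctured.exists_is_const_of_fderiv_eq_zero hconn
    (fun y hy => (hd.differentiableAt hy).differentiableWithinAt) (fun y hy => by
      ext e
      rw [IsC1.fderiv_radialExt hy, radialExt_of_ne _ hy, hv.ext_gradient hw]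
      simp)
  refine ⟨c, fun x => ?_⟩
  have := hc x x.ne_zero
  rw [radialExt_coe] at this
  linarith

lemma IsPoissonSolution.integral_norm_sq_eq {u : S2 → ℝ} {m : ℝ} {v w : S2 → ℝ}
    (hv : IsPoissonSolution u m v) (hw : IsPoissonSolution u m w) :
    ∫ x, ‖sphereGrad v x‖ ^ 2 ∂area = ∫ x, ‖sphereGrad w x‖ ^ 2 ∂area := by
  congr 1
  ext x
  have := hv.ext_gradient hw x
  rw [sphereGrad_sub hv.isC1 hw.isC1, sub_eq_zero] at this
  rw [this]

lemma IsPoissonSolution.integral_poissonSolution {u : S2 → ℝ} {m : ℝ} {v : S2 → ℝ}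
    (hv : IsPoissonSolution u m v) :
    ∫ x, ‖sphereGrad (poissonSolution u m) x‖ ^ 2 ∂area = ∫ x, ‖sphereGrad v x‖ ^ 2 ∂area := by
  have h : ∃ v, IsPoissonSolution u m v := ⟨v, hv⟩
  rw [poissonSolution, dif_pos h]
  exact h.choose_spec.integral_norm_sq_eq hv

/-- The difference of two Dirichlet energies, by symmetry of the weak formulation. -/
lemma IsPoissonSolution.dirichlet_sub {u u' : S2 → ℝ} {m : ℝ} {v v' : S2 → ℝ}
    (hv : IsPoissonSolution u m v) (hv' : IsPoissonSolution u' m v') :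
    ∫ x, ‖sphereGrad v' x‖ ^ 2 ∂area - ∫ x, ‖sphereGrad v x‖ ^ 2 ∂area
      = ∫ x, (u' x - m) * (v' x + v x) ∂area - ∫ x, (u x - m) * (v' x + v x) ∂area := by
  have hs := hv'.isC1.add hv.isC1
  have hvc := hv.isC1.continuous_sphereGrad
  have hvc' := hv'.isC1.continuous_sphereGrad
  -- Both equations are tested with `v' + v`; the mixed terms cancel in the difference.
  rw [← hv.weak _ hs, ← hv'.weak _ hs]
  simp only [sphereGrad_add hv'.isC1 hv.isC1, inner_add_right, real_inner_self_eq_norm_sq]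
  have i1 : Integrable (fun x => ‖sphereGrad v' x‖ ^ 2) area :=
    integrable_of_continuous (hvc'.norm.pow 2)
  have i2 : Integrable (fun x => ‖sphereGrad v x‖ ^ 2) area :=
    integrable_of_continuous (hvc.norm.pow 2)
  have i3 : Integrable (fun x => ⟪sphereGrad v' x, sphereGrad v x⟫) area :=
    integrable_of_continuous (hvc'.inner hvc)
  have i4 : Integrable (fun x => ⟪sphereGrad v x, sphereGrad v' x⟫) area :=
    integrable_of_continuous (hvc.inner hvc')
  rw [integral_add i1 i3, integral_add i4 i2]
  simp only [real_inner_comm]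
  ring

end Poisson

/-! ### The first variation of the energy in the interfaces. -/

section FirstVariation

variable {n : ℕ} {z : Fin n → ℝ}

/-- The interval shrinks to `a` as `t → 0`, so the dependence of `F` on `t` enters only through
continuity at `(0, a)`. -/
lemma hasDerivAt_integral_moving {F : ℝ → ℝ → ℝ} {a w : ℝ}
    (hF : ContinuousAt (Function.uncurry F) (0, a)) (hc : ∀ᶠ t in 𝓝 0, Continuous (F t)) :
    HasDerivAt (fun t => ∫ s in a..a + t * w, F t s) (w * F 0 a) 0 := by
  rw [hasDerivAt_iff_isLittleO, Asymptotics.isLittleO_iff]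
  intro c hcpos
  -- The `+ 1` allows for `w = 0`.
  have hc' : 0 < c / (|w| + 1) := by positivity
  obtain ⟨δ, hδ, h⟩ := Metric.continuousAt_iff.1 hF _ hc'
  have h1 : ∀ᶠ t in 𝓝 (0 : ℝ), |t| < δ := by
    have := Metric.ball_mem_nhds (0 : ℝ) hδ
    filter_upwards [this] with t ht
    simpa [Real.dist_eq] using ht
  have h2 : ∀ᶠ t in 𝓝 (0 : ℝ), |t * w| < δ := by
    have : Tendsto (fun t : ℝ => |t * w|) (𝓝 0) (𝓝 |0 * w|) :=
      (by fun_prop : Continuous fun t : ℝ => |t * w|).tendsto 0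
    rw [zero_mul, abs_zero] at this
    exact this.eventually (gt_mem_nhds hδ)
  filter_upwards [h1, h2, hc] with t ht1 ht2 ht3
  have e : (∫ s in a..a + t * w, F t s) - t * (w * F 0 a)
      = ∫ s in a..a + t * w, (F t s - F 0 a) := by
    rw [intervalIntegral.integral_sub (ht3.intervalIntegrable _ _) (by simp),
      intervalIntegral.integral_const]
    simp
    ring
  simp only [zero_mul, add_zero, intervalIntegral.integral_same, sub_zero, smul_eq_mul]
  rw [e]
  refine (intervalIntegral.norm_integral_le_of_norm_le_const (C := c / (|w| + 1))
    fun s hs => ?_).trans ?_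
  · have hsa : |s - a| ≤ |t * w| := by
      have := Set.abs_sub_left_of_mem_uIcc (Set.uIoc_subset_uIcc hs)
      simpa using this
    have := h (x := (t, s)) (by
      rw [Prod.dist_eq, max_lt_iff]
      simp only [Real.dist_eq, sub_zero]
      exact ⟨ht1, hsa.trans_lt ht2⟩)
    exact this.le
  · rw [add_sub_cancel_left, abs_mul, Real.norm_eq_abs]
    have hw : |w| ≤ |w| + 1 := by linarith
    calc c / (|w| + 1) * (|t| * |w|) = c * |t| * (|w| / (|w| + 1)) := by ring
      _ ≤ c * |t| * 1 := by
          gcongr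
          exact (div_le_one (by positivity)).2 hw
      _ = c * |t| := mul_one _

lemma continuousAt_capPotential {a h : ℝ} (ha : -1 < a) (ha1 : a < 1) :
    ContinuousAt (fun p : ℝ × ℝ => capPotential p.1 p.2) (a, h) := by
  unfold capPotential
  have h1 : ContinuousAt (fun p : ℝ × ℝ => Real.log (1 - min p.1 p.2)) (a, h) :=
    ContinuousAt.log (by fun_prop) (one_sub_min_pos ha1 h).ne'
  have h2 : ContinuousAt (fun p : ℝ × ℝ => Real.log (1 + max p.1 p.2)) (a, h) :=
    ContinuousAt.log (by fun_prop) (one_add_max_pos ha h).ne'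
  fun_prop

lemma integral_capInd_mul_height {a : ℝ} (ha : -1 < a) (ha1 : a < 1) {G : ℝ → ℝ}
    (hG : Continuous G) :
    ∫ x : S2, capInd a x * G ((x : E3) 2) ∂area = 2 * Real.pi * ∫ s in a..1, G s := by
  have h := integral_height (f := (Set.Ici a).indicator G)
    (hG.measurable.indicator measurableSet_Ici).aestronglyMeasurable
  have h2 : ∫ s in (-1 : ℝ)..1, (Set.Ici a).indicator G s = ∫ s in a..1, G s := by
    rw [intervalIntegral.integral_of_le (by norm_num), setIntegral_indicator measurableSet_Ici,
      show Set.Ioc (-1) 1 ∩ Set.Ici a = Set.Icc a 1 by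
        ext s; simp only [Set.mem_inter_iff, Set.mem_Ici, Set.mem_Ioc, Set.mem_Icc]
        exact ⟨fun h => ⟨h.2, h.1.2⟩, fun h => ⟨⟨by linarith [h.1], h.2⟩, h.1⟩⟩,
      intervalIntegral.integral_of_le ha1.le, integral_Icc_eq_integral_Ioc]
  rw [← h2, ← h]
  congr 1
  ext x
  by_cases hx : a ≤ (x : E3) 2 <;> simp [capInd, hx]

/-- The change of the Dirichlet energy of the potential when the interfaces move. -/
lemma dirichlet_pattern_sub {z' : Fin n → ℝ} {m : ℝ} (hz : IsInterfaces z)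
    (hm : mass (pattern z) = m) (hz' : IsInterfaces z') (hm' : mass (pattern z') = m) :
    ∫ x, ‖sphereGrad (poissonSolution (pattern z') m) x‖ ^ 2 ∂area
      - ∫ x, ‖sphereGrad (poissonSolution (pattern z) m) x‖ ^ 2 ∂area
      = ∑ k : Fin n, -(4 * Real.pi * (-1 : ℝ) ^ (k : ℕ)
        * ∫ s in z k..z' k, (patternProfile z' s + patternProfile z s)) := by
  have hv := isPoissonSolution_pattern hz hm
  have hv' := isPoissonSolution_pattern hz' hm'
  rw [hv.integral_poissonSolution, hv'.integral_poissonSolution, hv.dirichlet_sub hv']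
  set G : ℝ → ℝ := fun s => patternProfile z' s + patternProfile z s with hG
  have hGc : Continuous G :=
    (contDiff_patternProfile hz').continuous.add (contDiff_patternProfile hz).continuous
  have hGh : Continuous fun x : S2 => G ((x : E3) 2) := hGc.comp continuous_height
  have hsplit : ∀ {y : Fin n → ℝ}, IsInterfaces y →
      ∫ x, (pattern y x - m) * G ((x : E3) 2) ∂area = -(∫ x : S2, G ((x : E3) 2) ∂area)
        + (∑ k : Fin n, 2 * (-1 : ℝ) ^ (k : ℕ) * (2 * Real.pi * ∫ s in y k..1, G s))
        - ∫ x : S2, m * G ((x : E3) 2) ∂area := by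
    intro y hy
    have hmG : Integrable (fun x : S2 => m * G ((x : E3) 2)) area :=
      integrable_of_continuous (continuous_const.mul hGh)
    simp only [sub_mul]
    rw [integral_sub (integrable_pattern_mul hy.strictMono hGh) hmG,
      integral_pattern_mul hy.strictMono hGh]
    simp only [integral_capInd_mul_height (hy.gt_neg_one _) (hy.lt_one _) hGc]
  refine (congrArg₂ (· - ·) (hsplit hz') (hsplit hz)).trans ?_
  -- The terms with the plain integral of `G` and with `m` are common to both patterns; only the cap
  -- integrals differ.
  rw [sub_sub_sub_cancel_right, add_sub_add_left_eq_sub, ← Finset.sum_sub_distrib]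
  refine Finset.sum_congr rfl fun k _ => ?_
  rw [← intervalIntegral.integral_add_adjacent_intervals (a := z k) (b := z' k) (c := 1)
    (hGc.intervalIntegrable _ _) (hGc.intervalIntegrable _ _)]
  ring

lemma eventually_isInterfaces (hz : IsInterfaces z) (w : Fin n → ℝ) :
    ∀ᶠ t in 𝓝 (0 : ℝ), IsInterfaces fun k => z k + t * w k := by
  have hc : ∀ k, Tendsto (fun t : ℝ => z k + t * w k) (𝓝 0) (𝓝 (z k)) := fun k => by
    have := (by fun_prop : Continuous fun t : ℝ => z k + t * w k).tendsto 0
    simpa using this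
  have h1 : ∀ᶠ t in 𝓝 (0 : ℝ), ∀ i j, i < j → z i + t * w i < z j + t * w j := by
    simp only [eventually_all]
    intro i j hij
    exact (hc i).eventually_lt (hc j) (hz.strictMono hij)
  have h2 : ∀ᶠ t in 𝓝 (0 : ℝ), ∀ k, -1 < z k + t * w k :=
    eventually_all.2 fun k => (hc k).eventually (lt_mem_nhds (hz.gt_neg_one k))
  have h3 : ∀ᶠ t in 𝓝 (0 : ℝ), ∀ k, z k + t * w k < 1 :=
    eventually_all.2 fun k => (hc k).eventually (gt_mem_nhds (hz.lt_one k))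
  filter_upwards [h1, h2, h3] with t a b c using ⟨fun i j hij => a i j hij, b, c⟩

lemma mass_pattern_line (hz : IsInterfaces z) {w : Fin n → ℝ}
    (hw : ∑ k : Fin n, (-1 : ℝ) ^ (k : ℕ) * w k = 0) {t : ℝ}
    (ht : IsInterfaces fun k => z k + t * w k) :
    mass (pattern fun k => z k + t * w k) = mass (pattern z) := by
  rw [mass_pattern hz, mass_pattern ht]
  have : ∑ k : Fin n, (-1 : ℝ) ^ (k : ℕ) * (1 - (z k + t * w k))
      = ∑ k : Fin n, (-1 : ℝ) ^ (k : ℕ) * (1 - z k)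
        - t * ∑ k : Fin n, (-1 : ℝ) ^ (k : ℕ) * w k := by
    rw [Finset.mul_sum, ← Finset.sum_sub_distrib]
    exact Finset.sum_congr rfl fun k _ => by ring
  rw [this, hw]
  ring

lemma hasDerivAt_sqrt_one_sub_sq {a w : ℝ} (ha : -1 < a) (ha1 : a < 1) :
    HasDerivAt (fun t : ℝ => Real.sqrt (1 - (a + t * w) ^ 2)) (-(a / Real.sqrt (1 - a ^ 2)) * w)
      0 := by
  have hpos : 0 < 1 - a ^ 2 := by nlinarith
  have h1 : HasDerivAt (fun t : ℝ => 1 - (a + t * w) ^ 2) (-(2 * a * w)) 0 := by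
    have := ((((hasDerivAt_id (0 : ℝ)).mul_const w).const_add a).pow 2).const_sub 1
    simpa using this
  have h2 := h1.sqrt (by simpa using hpos.ne')
  convert! h2 using 1
  have := Real.sqrt_pos.2 hpos
  simp
  field_simp

/-- The derivative of the energy when the interfaces move with constant speeds that preserve
the mean. -/
theorem hasDerivAt_energy_line (hz : IsInterfaces z) {γ m : ℝ} (hm : mass (pattern z) = m)
    {w : Fin n → ℝ} (hw : ∑ k : Fin n, (-1 : ℝ) ^ (k : ℕ) * w k = 0) :
    HasDerivAt (fun t => energy γ m (pattern fun k => z k + t * w k))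
      (-(2 * Real.pi) * ∑ k : Fin n, (-1 : ℝ) ^ (k : ℕ) * w k
        * ((-1 : ℝ) ^ (k : ℕ) * (z k / Real.sqrt (1 - z k ^ 2))
          + 4 * γ * patternProfile z (z k))) 0 := by
  have hpi := Real.pi_pos
  have hI := eventually_isInterfaces hz w
  set D := ∫ x, ‖sphereGrad (poissonSolution (pattern z) m) x‖ ^ 2 ∂area with hD
  -- For small `t` the interfaces stay ordered and the mean stays `m`, so the formulas for perimeter
  -- and Dirichlet energy apply.
  have hE : (fun t => energy γ m (pattern fun k => z k + t * w k)) =ᶠ[𝓝 0] fun t =>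
      2 * Real.pi * (∑ k, Real.sqrt (1 - (z k + t * w k) ^ 2))
      + γ * (D + ∑ k : Fin n, -(4 * Real.pi * (-1 : ℝ) ^ (k : ℕ) * ∫ s in z k..z k + t * w k,
        (patternProfile (fun k => z k + t * w k) s + patternProfile z s))) := by
    filter_upwards [hI] with t ht
    have := dirichlet_pattern_sub hz hm ht ((mass_pattern_line hz hw ht).trans hm)
    rw [energy, totalVariation_pattern ht, ENNReal.toReal_ofReal
      (mul_nonneg (by positivity) (Finset.sum_nonneg fun k _ => Real.sqrt_nonneg _)),
      ← this, hD]
    ring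
  refine HasDerivAt.congr_of_eventuallyEq ?_ hE
  have h1 : HasDerivAt (fun t => 2 * Real.pi * (∑ k, Real.sqrt (1 - (z k + t * w k) ^ 2)))
      (2 * Real.pi * ∑ k, -(z k / Real.sqrt (1 - z k ^ 2)) * w k) 0 :=
    (HasDerivAt.fun_sum fun k _ =>
      hasDerivAt_sqrt_one_sub_sq (hz.gt_neg_one k) (hz.lt_one k)).const_mul _
  have h2 : ∀ k, HasDerivAt (fun t => ∫ s in z k..z k + t * w k,
      (patternProfile (fun k => z k + t * w k) s + patternProfile z s))
      (w k * (2 * patternProfile z (z k))) 0 := by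
    intro k
    have h := hasDerivAt_integral_moving (w := w k) (a := z k)
      (F := fun t s => patternProfile (fun k => z k + t * w k) s + patternProfile z s) ?_ ?_
    · convert! h using 2
      simp
      ring
    · refine ContinuousAt.add ?_ ?_
      · refine tendsto_finsetSum _ fun j _ => Tendsto.const_mul _ ?_
        have hj : ContinuousAt (fun p : ℝ × ℝ => capPotential p.1 p.2) (z j + 0 * w j, z k) :=
          continuousAt_capPotential (by simpa using hz.gt_neg_one j) (by simpa using hz.lt_one j)
        have hp : ContinuousAt (fun p : ℝ × ℝ => (z j + p.1 * w j, p.2)) ((0 : ℝ), z k) := by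
          fun_prop
        exact ContinuousAt.comp (f := fun p : ℝ × ℝ => (z j + p.1 * w j, p.2))
          (x := ((0 : ℝ), z k)) hj hp
      · exact ((contDiff_patternProfile hz).continuous.comp continuous_snd).continuousAt
    · filter_upwards [hI] with t ht
      exact (contDiff_patternProfile ht).continuous.add (contDiff_patternProfile hz).continuous
  have h3 := h1.add (((HasDerivAt.fun_sum fun k (_ : k ∈ Finset.univ) =>
    ((h2 k).const_mul (4 * Real.pi * (-1 : ℝ) ^ (k : ℕ))).neg).const_add D).const_mul γ)
  convert! h3 using 1
  rw [Finset.mul_sum, Finset.mul_sum, Finset.mul_sum, ← Finset.sum_add_distrib]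
  refine Finset.sum_congr rfl fun k _ => ?_
  have : (-1 : ℝ) ^ (k : ℕ) * (-1) ^ (k : ℕ) = 1 := by
    rw [← mul_pow]; simp
  linear_combination (-(2 * Real.pi) * w k * (z k / Real.sqrt (1 - z k ^ 2))) * this

/-- The Euler-Lagrange equation at the interfaces of a critical axisymmetric pattern. -/
theorem IsAxisymmetricCritical.exists_multiplier {γ m : ℝ} (hz : IsAxisymmetricCritical γ m z) :
    ∃ l : ℝ, ∀ k : Fin n, (-1 : ℝ) ^ (k : ℕ) * (z k / Real.sqrt (1 - z k ^ 2))
      + 4 * γ * patternProfile z (z k) = l := by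
  have hpi := Real.pi_pos
  rcases isEmpty_or_nonempty (Fin n) with he | ⟨⟨j⟩⟩
  · exact ⟨0, fun k => he.elim k⟩
  refine ⟨(-1 : ℝ) ^ (j : ℕ) * (z j / Real.sqrt (1 - z j ^ 2)) + 4 * γ * patternProfile z (z j),
    fun i => ?_⟩
  -- Only the interfaces `i` and `j` move, with speeds that cancel in the mean; the derivative
  -- becomes `-2π` times the difference of the two numbers.
  set w : Fin n → ℝ := fun k => Pi.single (M := fun _ => ℝ) i ((-1 : ℝ) ^ (i : ℕ)) k
    - Pi.single (M := fun _ => ℝ) j ((-1 : ℝ) ^ (j : ℕ)) k with hw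
  have hsum : ∀ f : Fin n → ℝ, ∑ k : Fin n, (-1 : ℝ) ^ (k : ℕ) * w k * f k = f i - f j := by
    intro f
    have hsq : ∀ k : Fin n, (-1 : ℝ) ^ (k : ℕ) * (-1) ^ (k : ℕ) = 1 := fun k => by
      rw [← mul_pow]; simp
    simp only [hw, mul_sub, sub_mul, Finset.sum_sub_distrib, Pi.single_apply, mul_ite, ite_mul,
      mul_zero, zero_mul, Finset.sum_ite_eq', Finset.mem_univ, if_true, hsq, one_mul]
  have hw0 : ∑ k : Fin n, (-1 : ℝ) ^ (k : ℕ) * w k = 0 := by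
    simpa using hsum fun _ => 1
  have hd := hasDerivAt_energy_line (γ := γ) hz.interfaces hz.mass_eq hw0
  have hs := hz.stationary (fun t k => z k + t * w k) (by fun_prop) (by simp) (by
    filter_upwards [eventually_isInterfaces hz.interfaces w] with t ht
    exact (mass_pattern_line hz.interfaces hw0 ht).trans hz.mass_eq)
  have h := hd.unique hs
  rw [hsum] at h
  have h' := (mul_eq_zero.1 h).resolve_left (by linarith)
  linarith

end FirstVariation

/-! ### The boundary of the region and its geodesic curvature. -/

section Boundary

variable {n : ℕ} {z : Fin n → ℝ}

lemma eventually_le_iff {b h : ℝ} (hne : b ≠ h) : ∀ᶠ s in 𝓝 h, (b ≤ s ↔ b ≤ h) := by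
  rcases hne.lt_or_gt with hlt | hgt
  · filter_upwards [lt_mem_nhds hlt] with s hs
    exact ⟨fun _ => hlt.le, fun _ => hs.le⟩
  · filter_upwards [gt_mem_nhds hgt] with s hs
    exact ⟨fun hc => absurd hc (not_le.2 hs), fun hc => absurd hc (not_le.2 hgt)⟩

/-- Away from the interfaces a pattern is locally constant. -/
lemma pattern_eventually_eq {x : S2} (hx : ∀ k, z k ≠ (x : E3) 2) :
    ∀ᶠ y in 𝓝 x, pattern z y = pattern z x := by
  have h : ∀ᶠ y : S2 in 𝓝 x, ∀ k, (z k ≤ (y : E3) 2 ↔ z k ≤ (x : E3) 2) :=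
    eventually_all.2 fun k =>
      continuous_height.continuousAt.eventually (eventually_le_iff (hx k))
  filter_upwards [h] with y hy
  simp only [pattern, hy]

/-- Near an interface the set where the pattern equals one lies on one side. -/
lemma pattern_eq_one_iff (hz : StrictMono z) (k : Fin n) :
    ∀ᶠ h in 𝓝 (z k), h ≠ z k → ∀ x : S2, (x : E3) 2 = h →
      (pattern z x = 1 ↔ 0 < (-1 : ℝ) ^ (k : ℕ) * (h - z k)) := by
  have h : ∀ᶠ h in 𝓝 (z k), ∀ j, j ≠ k → (z j ≤ h ↔ z j ≤ z k) := by
    refine eventually_all.2 fun j => ?_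
    by_cases hj : j = k
    · simp [hj]
    · filter_upwards [eventually_le_iff (hz.injective.ne hj)] with s hs _ using hs
  filter_upwards [h] with s hs hne x hx
  rcases hne.lt_or_gt with hlt | hgt
  -- With indices from 0, exactly `k` interfaces lie below a point just under `z k`, and `k + 1`
  -- below a point just above it.
  · have hc : (Finset.univ.filter fun j => z j ≤ (x : E3) 2) = Finset.Iio k := by
      ext j
      rw [Finset.mem_filter, Finset.mem_Iio, hx]
      by_cases hj : j = k
      · subst hj; simpa using hlt
      · simp [hs j hj, hz.le_iff_le, lt_iff_le_and_ne, hj]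
    have hp : pattern z x = -(-1) ^ (k : ℕ) := by
      rw [pattern, hc, Fin.card_Iio]; ring
    rw [hp]
    rcases neg_one_pow_eq_or ℝ (k : ℕ) with e | e <;> rw [e]
    · constructor <;> intro h <;> linarith
    · constructor <;> intro h <;> linarith
  · have hc : (Finset.univ.filter fun j => z j ≤ (x : E3) 2) = Finset.Iic k := by
      ext j
      rw [Finset.mem_filter, Finset.mem_Iic, hx]
      by_cases hj : j = k
      · subst hj; simpa using hgt.le
      · simp [hs j hj, hz.le_iff_le]
    have hp : pattern z x = (-1) ^ (k : ℕ) := by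
      rw [pattern, hc, Fin.card_Iic]; ring
    rw [hp]
    rcases neg_one_pow_eq_or ℝ (k : ℕ) with e | e <;> rw [e]
    · constructor <;> intro h <;> linarith
    · constructor <;> intro h <;> linarith

/-- The great circle through `x` with unit velocity `ν`. -/
noncomputable def greatCircle (x : S2) (ν : E3) (hν : ‖ν‖ = 1) (ht : ⟪ν, (x : E3)⟫ = 0)
    (s : ℝ) : S2 :=
  ⟨Real.cos s • (x : E3) + Real.sin s • ν, by
    rw [mem_sphere_zero_iff_norm, ← sq_eq_sq₀ (norm_nonneg _) zero_le_one, norm_add_sq_real,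
      norm_smul, norm_smul, inner_smul_left, inner_smul_right, real_inner_comm, ht, hν, S2.norm_coe]
    simp⟩

lemma greatCircle_height (x : S2) {ν : E3} (hν : ‖ν‖ = 1) (ht : ⟪ν, (x : E3)⟫ = 0) (s : ℝ) :
    (greatCircle x ν hν ht s : E3) 2 = Real.cos s * (x : E3) 2 + Real.sin s * ν 2 := by
  simp [greatCircle]

lemma tendsto_greatCircle (x : S2) {ν : E3} (hν : ‖ν‖ = 1) (ht : ⟪ν, (x : E3)⟫ = 0) :
    Tendsto (greatCircle x ν hν ht) (𝓝 0) (𝓝 x) := by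
  have hc : Continuous (greatCircle x ν hν ht) :=
    Continuous.subtype_mk (by fun_prop) _
  have h0 : greatCircle x ν hν ht 0 = x := Subtype.ext (by simp [greatCircle])
  simpa [h0] using hc.tendsto 0

/-- Along the great circle the height has derivative `b` at 0, so its increment has the sign of `s *
b`. -/
lemma eventually_height_sign (h : ℝ) {b : ℝ} (hb : b ≠ 0) :
    ∀ᶠ s in 𝓝[≠] (0 : ℝ), 0 < s * b * (Real.cos s * h + Real.sin s * b - h) := by
  have hd : HasDerivAt (fun s => Real.cos s * h + Real.sin s * b) b 0 := by
    have := ((Real.hasDerivAt_cos 0).mul_const h).add ((Real.hasDerivAt_sin 0).mul_const b)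
    refine this.congr_deriv ?_
    simp
  have hs := (hd.tendsto_slope.mul_const b).eventually
    (lt_mem_nhds (show 0 < b * b from mul_self_pos.2 hb))
  filter_upwards [hs, self_mem_nhdsWithin] with s h1 h2
  have h2 : s ≠ 0 := h2
  simp only [slope, vsub_eq_sub, sub_zero, smul_eq_mul, Real.cos_zero, Real.sin_zero, one_mul,
    zero_mul, add_zero] at h1
  have h3 : 0 < s ^ 2 := by positivity
  have h4 := mul_pos h3 h1
  have h5 : s ^ 2 * (s⁻¹ * (Real.cos s * h + Real.sin s * b - h) * b)
      = s * b * (Real.cos s * h + Real.sin s * b - h) := by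
    field_simp
  rwa [h5] at h4

/-- Membership in the set where the pattern equals one along a great circle transversal to an
interface. -/
lemma eventually_greatCircle_mem_iff (hz : StrictMono z) (k : Fin n) {x : S2}
    (hx : (x : E3) 2 = z k) {ν : E3} (hν : ‖ν‖ = 1) (ht : ⟪ν, (x : E3)⟫ = 0) (hν2 : ν 2 ≠ 0) :
    ∀ᶠ s in 𝓝[≠] (0 : ℝ), pattern z (greatCircle x ν hν ht s) = 1
      ↔ 0 < (-1 : ℝ) ^ (k : ℕ) * (s * ν 2) := by
  have h1 := eventually_height_sign (z k) hν2
  have hc : Tendsto (fun s => (greatCircle x ν hν ht s : E3) 2) (𝓝[≠] 0) (𝓝 (z k)) := by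
    rw [← hx]
    exact ((continuous_height.tendsto x).comp (tendsto_greatCircle x hν ht)).mono_left
      nhdsWithin_le_nhds
  filter_upwards [h1, hc.eventually (pattern_eq_one_iff hz k)] with s h1 h2
  have hh := greatCircle_height x hν ht s
  rw [hx] at hh
  have hne : (greatCircle x ν hν ht s : E3) 2 ≠ z k := by
    intro hc
    rw [← hh, hc, sub_self, mul_zero] at h1
    exact h1.false
  rw [h2 hne _ rfl, hh]
  set d := Real.cos s * z k + Real.sin s * ν 2 - z k
  rcases neg_one_pow_eq_or ℝ (k : ℕ) with e | e <;> rw [e]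
  · rw [one_mul, one_mul]
    exact (pos_iff_pos_of_mul_pos h1).symm
  · rw [neg_one_mul, neg_one_mul, neg_pos, neg_pos]
    exact (neg_iff_neg_of_mul_pos h1).symm

lemma one_sub_sq_pos (hz : IsInterfaces z) (k : Fin n) : 0 < 1 - z k ^ 2 := by
  nlinarith [hz.gt_neg_one k, hz.lt_one k]

/-- The outer unit normal at a point of height `z k` of the set where the pattern equals one. -/
noncomputable def outerNormal (z : Fin n → ℝ) (k : Fin n) (x : S2) : E3 :=
  (-((-1 : ℝ) ^ (k : ℕ)) / Real.sqrt (1 - z k ^ 2)) • (e3 - (x : E3) 2 • (x : E3))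

lemma norm_outerNormal (hz : IsInterfaces z) {k : Fin n} {x : S2} (hx : (x : E3) 2 = z k) :
    ‖outerNormal z k x‖ = 1 := by
  have hpos := Real.sqrt_pos.2 (one_sub_sq_pos hz k)
  rw [outerNormal, norm_smul, norm_tangent_height, hx, norm_div, norm_neg, norm_pow,
    Real.norm_of_nonneg hpos.le]
  simp [hpos.ne']

lemma inner_outerNormal (k : Fin n) (x : S2) : ⟪outerNormal z k x, (x : E3)⟫ = 0 := by
  rw [outerNormal, inner_smul_left, inner_sub_left, inner_smul_left, S2.inner_self, e3_inner]
  simp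

lemma outerNormal_height (hz : IsInterfaces z) {k : Fin n} {x : S2} (hx : (x : E3) 2 = z k) :
    outerNormal z k x 2 = -((-1 : ℝ) ^ (k : ℕ)) * Real.sqrt (1 - z k ^ 2) := by
  have hpos := one_sub_sq_pos hz k
  have h1 := Real.sq_sqrt hpos.le
  have h2 := Real.sqrt_pos.2 hpos
  simp only [outerNormal, PiLp.smul_apply, PiLp.sub_apply, e3_apply_two, smul_eq_mul, hx]
  rw [show (1 : ℝ) - z k * z k = Real.sqrt (1 - z k ^ 2) ^ 2 by rw [h1]; ring]
  field_simp

lemma eventually_outerNormal (hz : IsInterfaces z) {k : Fin n} {x : S2}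
    (hx : (x : E3) 2 = z k) :
    ∀ᶠ s in 𝓝[≠] (0 : ℝ), pattern z (greatCircle x (outerNormal z k x)
      (norm_outerNormal hz hx) (inner_outerNormal k x) s) = 1 ↔ s < 0 := by
  have hpos := Real.sqrt_pos.2 (one_sub_sq_pos hz k)
  have hsq : (-1 : ℝ) ^ (k : ℕ) * (-1) ^ (k : ℕ) = 1 := by
    rw [← mul_pow]; simp
  have hne : outerNormal z k x 2 ≠ 0 := by
    rw [outerNormal_height hz hx]
    exact mul_ne_zero (neg_ne_zero.2 (pow_ne_zero _ (by norm_num))) hpos.ne'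
  filter_upwards [eventually_greatCircle_mem_iff hz.strictMono k hx (norm_outerNormal hz hx)
    (inner_outerNormal k x) hne] with s hs
  rw [hs, outerNormal_height hz hx, show (-1 : ℝ) ^ (k : ℕ) * (s * (-(-1) ^ (k : ℕ)
    * Real.sqrt (1 - z k ^ 2))) = -s * Real.sqrt (1 - z k ^ 2) * ((-1 : ℝ) ^ (k : ℕ)
      * (-1) ^ (k : ℕ)) by ring, hsq, mul_one, mul_pos_iff_of_pos_right hpos, neg_pos]

/-- The boundary of the set where the pattern equals one is the union of the interfaces. -/
lemma mem_frontier_iff (hz : IsInterfaces z) (x : S2) :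
    x ∈ frontier {x | pattern z x = 1} ↔ ∃ k, (x : E3) 2 = z k := by
  constructor
  · intro hx
    by_contra! hne
    have h := pattern_eventually_eq (z := z) (x := x) fun k => (hne k).symm
    rw [frontier_eq_closure_inter_closure] at hx
    by_cases h1 : pattern z x = 1
    · refine (mem_closure_iff_frequently.1 hx.2) ?_
      filter_upwards [h] with y hy
      simp [hy, h1]
    · refine (mem_closure_iff_frequently.1 hx.1) ?_
      filter_upwards [h] with y hy
      simp [hy, h1]
  · rintro ⟨k, hk⟩
    -- The great circle normal to the interface approaches `x` from inside and from outside.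
    have h := eventually_outerNormal hz hk
    have ht := tendsto_greatCircle x (norm_outerNormal hz hk) (inner_outerNormal k x)
    rw [frontier_eq_closure_inter_closure]
    constructor
    · refine mem_closure_of_tendsto (ht.mono_left (nhdsWithin_le_nhds (s := Set.Iio 0))) ?_
      filter_upwards [nhdsWithin_mono _ (fun s (hs : s < 0) => hs.ne) h, self_mem_nhdsWithin]
        with s h1 h2
      exact h1.2 h2
    · refine mem_closure_of_tendsto (ht.mono_left (nhdsWithin_le_nhds (s := Set.Ioi 0))) ?_
      filter_upwards [nhdsWithin_mono _ (fun s (hs : 0 < s) => hs.ne') h, self_mem_nhdsWithin]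
        with s h1 h2
      exact fun hc => lt_asymm h2 (h1.1 hc)

/-- The parallel through `x`, parametrized by arc length. -/
noncomputable def parallel (x : S2) (ρ : ℝ) (s : ℝ) : E3 :=
  (x : E3) 2 • e3 + Real.cos (s / ρ) • ((x : E3) - (x : E3) 2 • e3)
    + Real.sin (s / ρ) • !₂[-(x : E3) 1, (x : E3) 0, 0]

lemma norm_parallel (x : S2) (ρ s : ℝ) : ‖parallel x ρ s‖ = 1 := by
  rw [← sq_eq_sq₀ (norm_nonneg _) zero_le_one, norm_sq_coords]
  simp [parallel, e3]
  have h1 := S2.coords x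
  have h2 := Real.sin_sq_add_cos_sq (s / ρ)
  linear_combination h1 + ((x : E3) 0 ^ 2 + (x : E3) 1 ^ 2) * h2

lemma contDiff_parallel (x : S2) (ρ : ℝ) : ContDiff ℝ 2 (parallel x ρ) := by
  unfold parallel
  fun_prop

lemma parallel_height (x : S2) (ρ s : ℝ) : parallel x ρ s 2 = (x : E3) 2 := by
  simp [parallel, e3]

lemma deriv_parallel (x : S2) (ρ s : ℝ) : deriv (parallel x ρ) s
    = (-Real.sin (s / ρ) * ρ⁻¹) • ((x : E3) - (x : E3) 2 • e3)
      + (Real.cos (s / ρ) * ρ⁻¹) • !₂[-(x : E3) 1, (x : E3) 0, 0] := by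
  have hd : HasDerivAt (fun s : ℝ => s / ρ) ρ⁻¹ s := by
    simpa using (hasDerivAt_id s).div_const ρ
  have h := ((hd.cos.smul_const ((x : E3) - (x : E3) 2 • e3)).const_add ((x : E3) 2 • e3)).add
    (hd.sin.smul_const (!₂[-(x : E3) 1, (x : E3) 0, 0] : E3))
  exact h.deriv

/-- Provides the existence half of `IsGeodesicCurvature`, so that the statement about all boundary
curves is not vacuous. -/
lemma isBoundaryCurve_parallel (hz : IsInterfaces z) {k : Fin n} {x : S2}
    (hx : (x : E3) 2 = z k) :
    IsBoundaryCurve {x | pattern z x = 1} x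
      (fun s => ⟨parallel x (Real.sqrt (1 - z k ^ 2)) s,
        mem_sphere_zero_iff_norm.2 (norm_parallel _ _ _)⟩) (outerNormal z k x) := by
  have hpos := one_sub_sq_pos hz k
  have hsq := Real.sq_sqrt hpos.le
  set ρ := Real.sqrt (1 - z k ^ 2) with hρ
  have hρ0 : 0 < ρ := Real.sqrt_pos.2 hpos
  have h := eventually_outerNormal hz hx
  have hcoord := S2.coords x
  refine ⟨(contDiff_parallel x ρ).contDiffAt, Subtype.ext (by simp [parallel]),
    Eventually.of_forall fun s => (mem_frontier_iff hz _).2 ⟨k, (parallel_height x ρ s).trans hx⟩,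
    Eventually.of_forall fun s => ?_, norm_outerNormal hz hx, inner_outerNormal k x, ?_, ?_, ?_⟩
  · show ‖deriv (parallel x ρ) s‖ = 1
    rw [deriv_parallel, ← sq_eq_sq₀ (norm_nonneg _) zero_le_one, norm_sq_coords]
    simp [e3]
    field_simp
    have h2 := Real.sin_sq_add_cos_sq (s / ρ)
    rw [hsq, ← hx]
    linear_combination hcoord + ((x : E3) 0 ^ 2 + (x : E3) 1 ^ 2) * h2
  · show ⟪outerNormal z k x, deriv (parallel x ρ) 0⟫ = 0
    rw [deriv_parallel, outerNormal, inner_smul_left, PiLp.inner_apply]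
    simp [Fin.sum_univ_three, e3]
    right
    ring
  · filter_upwards [nhdsWithin_mono _ (fun s (hs : 0 < s) => hs.ne') h, self_mem_nhdsWithin]
      with s h1 h2
    rintro ⟨y, hy, hys⟩
    have : y = greatCircle x (outerNormal z k x) (norm_outerNormal hz hx)
      (inner_outerNormal k x) s := Subtype.ext hys
    rw [Set.mem_ofPred_eq, this] at hy
    exact lt_asymm h2 (h1.1 hy)
  · filter_upwards [nhdsWithin_mono _ (fun s (hs : s < 0) => hs.ne) h, self_mem_nhdsWithin]
      with s h1 h2
    exact ⟨_, h1.2 h2, rfl⟩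

/-- The interfaces form a finite set of heights, so a continuous function with values among them is
locally constant. -/
lemma eventually_height_eq (hz : StrictMono z) {k : Fin n} {c : ℝ → ℝ} (hc : ContinuousAt c 0)
    (h0 : c 0 = z k) (hm : ∀ᶠ s in 𝓝 (0 : ℝ), ∃ j, c s = z j) : ∀ᶠ s in 𝓝 (0 : ℝ), c s = z k := by
  have h : ∀ᶠ s in 𝓝 (0 : ℝ), ∀ j, j ≠ k → c s ≠ z j := by
    refine eventually_all.2 fun j => ?_
    by_cases hj : j = k
    · simp [hj]
    · filter_upwards [hc.eventually_ne (by rw [h0]; exact hz.injective.ne (Ne.symm hj))]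
        with s hs _ using hs
  filter_upwards [h, hm] with s h1 h2
  obtain ⟨j, hj⟩ := h2
  by_cases hjk : j = k
  · rw [hj, hjk]
  · exact absurd hj (h1 j hjk)

/-- The algebra behind the curvature of a parallel: `x` is the point, `t`, `a` are velocity and
acceleration of the curve, and `ν` is normal to it. -/
lemma normal_acceleration {x t a ν : E3} (hx : ‖x‖ = 1) (ht : ‖t‖ = 1) (hν : ‖ν‖ = 1)
    (htx : ⟪t, x⟫ = 0) (hνx : ⟪ν, x⟫ = 0) (hνt : ⟪ν, t⟫ = 0) (hax : ⟪a, x⟫ = -1)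
    (ht2 : t 2 = 0) (ha2 : a 2 = 0) :
    ν 2 ^ 2 = 1 - x 2 ^ 2 ∧ ⟪a, ν⟫ * (1 - x 2 ^ 2) = ν 2 * x 2 := by
  have hx' := norm_sq_coords x
  have ht' := norm_sq_coords t
  have hν' := norm_sq_coords ν
  rw [hx] at hx'
  rw [ht, ht2] at ht'
  rw [hν] at hν'
  simp only [PiLp.inner_apply, Fin.sum_univ_three, RCLike.inner_apply, conj_trivial] at *
  rw [ht2] at htx hνt
  rw [ha2] at hax ⊢
  have hT : t 0 ^ 2 + t 1 ^ 2 = 1 := by linarith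
  set α := ν 0 * t 1 - ν 1 * t 0 with hα
  set β := x 0 * t 1 - x 1 * t 0 with hβ
  have n0 : ν 0 = α * t 1 := by rw [hα]; linear_combination (-ν 0) * hT + t 0 * hνt
  have n1 : ν 1 = -(α * t 0) := by rw [hα]; linear_combination (-ν 1) * hT + t 1 * hνt
  have x0 : x 0 = β * t 1 := by rw [hβ]; linear_combination (-x 0) * hT + t 0 * htx
  have x1 : x 1 = -(β * t 0) := by rw [hβ]; linear_combination (-x 1) * hT + t 1 * htx
  have hβ2 : β ^ 2 = 1 - x 2 ^ 2 := by
    rw [x0, x1] at hx'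
    linear_combination (-β ^ 2) * hT - hx'
  have hα2 : α ^ 2 = 1 - ν 2 ^ 2 := by
    rw [n0, n1] at hν'
    linear_combination (-α ^ 2) * hT - hν'
  have hαβ : α * β = -(ν 2 * x 2) := by
    rw [n0, n1, x0, x1] at hνx
    linear_combination (-α * β) * hT + hνx
  have hβa : β * (a 0 * t 1 - a 1 * t 0) = -1 := by
    rw [x0, x1] at hax
    linear_combination hax
  constructor
  · have : (α * β) ^ 2 = (ν 2 * x 2) ^ 2 := by rw [hαβ]; ring
    rw [mul_pow, hα2, hβ2] at this
    linear_combination -this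
  · rw [n0, n1, ← hβ2]
    linear_combination (α * β) * hβa - hαβ

/-- A boundary curve stays at height `z k`, so velocity and acceleration are horizontal;
differentiating `⟪C, C⟫ = 1` twice gives `⟪C'', x⟫ = -1`. This fixes the normal acceleration up to
the sign of `ν`. -/
lemma IsBoundaryCurve.curvature_eq (hz : IsInterfaces z) {k : Fin n} {x : S2}
    (hx : (x : E3) 2 = z k) {c : ℝ → S2} {ν : E3}
    (h : IsBoundaryCurve {x | pattern z x = 1} x c ν) :
    (-1 : ℝ) ^ (k : ℕ) * (z k / Real.sqrt (1 - z k ^ 2))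
      = -⟪deriv (deriv fun s => (c s : E3)) 0, ν⟫ := by
  set C : ℝ → E3 := fun s => (c s : E3) with hC
  have hC0 : C 0 = x := by rw [hC]; simp [h.start]
  have hd : ∀ᶠ s in 𝓝 (0 : ℝ), HasDerivAt C (deriv C s) s := by
    have := (h.smooth.eventually (by simp)).mono fun s hs => hs.differentiableAt two_ne_zero
    exact this.mono fun s hs => hs.hasDerivAt
  have hdd : HasDerivAt (deriv C) (deriv (deriv C) 0) 0 := by
    have : DifferentiableAt ℝ (fderiv ℝ C) 0 :=
      (h.smooth.fderiv_right (m := 1) (by norm_num)).differentiableAt one_ne_zero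
    exact (this.clm_apply (differentiableAt_const (1 : ℝ))).hasDerivAt
  have hheight : ∀ᶠ s in 𝓝 (0 : ℝ), C s 2 = z k := by
    refine eventually_height_eq hz.strictMono (c := fun s => C s 2) ?_ (by rw [hC0, hx]) ?_
    · have := h.smooth.continuousAt
      fun_prop
    · filter_upwards [h.mem_boundary] with s hs using (mem_frontier_iff hz _).1 hs
  have hT2 : ∀ᶠ s in 𝓝 (0 : ℝ), deriv C s 2 = 0 := by
    filter_upwards [hd, hheight.eventually_nhds] with s h1 h2
    have h3 := (innerSL ℝ e3).hasFDerivAt.comp_hasDerivAt s h1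
    have h4 : HasDerivAt ((innerSL ℝ e3) ∘ C) 0 s :=
      (hasDerivAt_const s (z k)).congr_of_eventuallyEq (by
        filter_upwards [h2] with t ht
        simp [e3_inner, ht])
    simpa [e3_inner] using h3.unique h4
  have hK2 : deriv (deriv C) 0 2 = 0 := by
    have h3 := (innerSL ℝ e3).hasFDerivAt.comp_hasDerivAt 0 hdd
    have h4 : HasDerivAt ((innerSL ℝ e3) ∘ deriv C) 0 0 :=
      (hasDerivAt_const 0 (0 : ℝ)).congr_of_eventuallyEq (by
        filter_upwards [hT2] with t ht
        simp [e3_inner, ht])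
    simpa [e3_inner] using h3.unique h4
  have hTC : ∀ᶠ s in 𝓝 (0 : ℝ), ⟪deriv C s, C s⟫ = 0 := by
    filter_upwards [hd] with s h1
    have h3 := h1.inner ℝ h1
    have h4 : HasDerivAt (fun s => ⟪C s, C s⟫) 0 s :=
      (hasDerivAt_const s (1 : ℝ)).congr_of_eventuallyEq
        (Eventually.of_forall fun t => S2.inner_self (c t))
    have := h3.unique h4
    rw [real_inner_comm] at this
    linarith
  have hT1 : ‖deriv C 0‖ = 1 := h.unit_speed.self_of_nhds
  have hKx : ⟪deriv (deriv C) 0, (x : E3)⟫ = -1 := by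
    have h3 := hdd.inner ℝ hd.self_of_nhds
    have h4 : HasDerivAt (fun s => ⟪deriv C s, C s⟫) 0 0 :=
      (hasDerivAt_const 0 (0 : ℝ)).congr_of_eventuallyEq hTC
    have := h3.unique h4
    rw [real_inner_self_eq_norm_sq, hT1, hC0] at this
    linarith
  have hTx : ⟪deriv C 0, (x : E3)⟫ = 0 := by
    have := hTC.self_of_nhds; rwa [hC0] at this
  obtain ⟨hν2, hK⟩ := normal_acceleration (S2.norm_coe x) hT1 h.norm_normal hTx h.normal_tangent
    h.normal_orthogonal hKx hT2.self_of_nhds hK2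
  rw [hx] at hν2 hK
  have hpos := one_sub_sq_pos hz k
  have hsq := Real.sq_sqrt hpos.le
  set ρ := Real.sqrt (1 - z k ^ 2) with hρ
  have hρ0 : 0 < ρ := Real.sqrt_pos.2 hpos
  have hνne : ν 2 ≠ 0 := fun hc => by rw [hc] at hν2; linarith
  -- The sign is fixed because the great circle with velocity `ν` must leave the region.
  have hsign : (-1 : ℝ) ^ (k : ℕ) * ν 2 < 0 := by
    have h1 := eventually_greatCircle_mem_iff hz.strictMono k hx h.norm_normal h.normal_tangent hνne
    have h2 := h1.filter_mono
      (nhdsWithin_mono (0 : ℝ) (s := Set.Ioi 0) fun s (hs : 0 < s) => hs.ne')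
    obtain ⟨s, ⟨hs1, hs2⟩, hs3⟩ := ((h2.and h.outside).and self_mem_nhdsWithin).exists
    have hs3 : 0 < s := hs3
    have hs4 : ¬ 0 < (-1 : ℝ) ^ (k : ℕ) * (s * ν 2) := fun hc => hs2 ⟨_, hs1.2 hc, rfl⟩
    rw [show (-1 : ℝ) ^ (k : ℕ) * (s * ν 2) = s * ((-1 : ℝ) ^ (k : ℕ) * ν 2) by ring,
      mul_pos_iff_of_pos_left hs3, not_lt] at hs4
    exact lt_of_le_of_ne hs4 (mul_ne_zero (pow_ne_zero _ (by norm_num)) hνne)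
  have hee : (-1 : ℝ) ^ (k : ℕ) * (-1) ^ (k : ℕ) = 1 := by
    rw [← mul_pow]; simp
  have hνeq : (-1 : ℝ) ^ (k : ℕ) * ν 2 = -ρ := by
    have : ((-1 : ℝ) ^ (k : ℕ) * ν 2) ^ 2 = (-ρ) ^ 2 := by
      rw [mul_pow, neg_sq, hsq, hν2, pow_two ((-1 : ℝ) ^ (k : ℕ)), hee, one_mul]
    rcases sq_eq_sq_iff_eq_or_eq_neg.1 this with h | h
    · exact h
    · rw [neg_neg] at h; linarith
  have hν3 : ν 2 = -((-1 : ℝ) ^ (k : ℕ) * ρ) := by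
    linear_combination (-1 : ℝ) ^ (k : ℕ) * hνeq - ν 2 * hee
  rw [← hsq, hν3] at hK
  have : ⟪deriv (deriv C) 0, ν⟫ = -((-1 : ℝ) ^ (k : ℕ) * (z k / ρ)) := by
    refine mul_right_cancel₀ (pow_ne_zero 2 hρ0.ne') (hK.trans ?_)
    field_simp
  rw [this, neg_neg]

theorem isGeodesicCurvature_pattern (hz : IsInterfaces z) {k : Fin n} {x : S2}
    (hx : (x : E3) 2 = z k) :
    IsGeodesicCurvature {x | pattern z x = 1} x
      ((-1 : ℝ) ^ (k : ℕ) * (z k / Real.sqrt (1 - z k ^ 2))) :=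
  ⟨⟨_, _, isBoundaryCurve_parallel hz hx⟩, fun _ _ h => h.curvature_eq hz hx⟩

end Boundary

end SphereOK

/-! ### The full Euler–Lagrange equation. -/

open SphereOK in
theorem proposition4p4 {n : ℕ} (γ m : ℝ) (hγ : 0 < γ) (z : Fin n → ℝ)
    (hz : IsAxisymmetricCritical γ m z) (A : Set S2) (hA : A = {x | pattern z x = 1}) :
    ∃ κ : S2 → ℝ,
      (∀ x ∈ frontier A, IsGeodesicCurvature A x (κ x)) ∧
      (∃ v : S2 → ℝ, IsPoissonSolution (pattern z) m v) ∧
      ∀ v : S2 → ℝ, IsPoissonSolution (pattern z) m v →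
        -- the Euler-Lagrange equation, with one constant on all of `∂A`
        (∃ l : ℝ, ∀ x ∈ frontier A, κ x + 4 * γ * v x = l) ∧
        -- the first variation vanishes for all admissible normal speeds `f` on `∂A`
        (∀ f : E3 → ℝ, ContDiff ℝ ∞ f →
          ∫ x in frontier A, f (x : E3) ∂(Measure.hausdorffMeasure 1 : Measure S2) = 0 →
          ∫ x in frontier A, (κ x + 4 * γ * v x) * f (x : E3)
            ∂(Measure.hausdorffMeasure 1 : Measure S2) = 0) := by
  classical
  subst hA
  have hI := hz.interfaces
  have hV := isPoissonSolution_pattern hI hz.mass_eq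
  obtain ⟨l, hl⟩ := hz.exists_multiplier
  -- Defined on the whole sphere through the multiplier; by `hl` it agrees with the geodesic
  -- curvature on the interfaces.
  let κ : S2 → ℝ := fun x => l - 4 * γ * patternProfile z ((x : E3) 2)
  have hκ : ∀ (x : S2) (k : Fin n), (x : E3) 2 = z k →
      κ x = (-1 : ℝ) ^ (k : ℕ) * (z k / Real.sqrt (1 - z k ^ 2)) := by
    intro x k hk
    simp only [κ, hk, ← hl k]
    ring
  refine ⟨κ, fun x hx => ?_, ⟨_, hV⟩, fun v hv => ?_⟩
  · obtain ⟨k, hk⟩ := (mem_frontier_iff hI x).1 hx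
    rw [hκ x k hk]
    exact isGeodesicCurvature_pattern hI hk
  · obtain ⟨c, hc⟩ := hv.exists_eq_add hV
    have hEL : ∀ x : S2, κ x + 4 * γ * v x = l + 4 * γ * c := fun x => by
      simp only [κ, hc x]
      ring
    refine ⟨⟨l + 4 * γ * c, fun x _ => hEL x⟩, fun f _ hf => ?_⟩
    -- The first variation density is a constant, so it factors out of the integral against `f`.
    simp only [hEL]
    rw [integral_const_mul, hf, mul_zero]
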